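/- Let $d,n$ be integers with $d\ge 2$, $n\ge 1$, let $\rho>0$, and let $\mathcal X\subset\mathbb R^d$ be the sphere of radius $\sqrt d$ centred at $0$ with its uniform distribution $\mu$. Let $G$ be a compact, second countable, Hausdorff topological group with normalised Haar measure $\lambda$, and let $\phi:G\to \mathrm O(d)$ be an orthogonal representation whose action $(g,x)\mapsto\phi(g)x$ on $\mathcal X$ is measurable. Put $\Phi=\int_G\phi(g)\,d\lambda(g)$, let $\|\cdot\|_F$ be the Frobenius norm, let $S\subseteq\mathbb R^d$ be the space of vectors fixed by $\phi$ and let $A=S^\perp$. For $f:\mathcal X\to\mathbb R$ write $\mathcal O f(x)=\int_G f(\phi(g)x)\,d\lambda(g)$. Let $k(x,y)=x^\top y$ be the linear kernel on $\mathcal X$, with reproducing kernel Hilbert space $\mathcal H$, and write $k^\perp(x,y)=k(x,y)-\int_G k(x,\phi(g)y)\,d\lambda(g)$ and $M_k=\sup_{x\in\mathcal X}k(x,x)$. Let $\theta\in\mathbb R^d$ be such that $f^\star(x)=\theta^\top x$ is $G$-invariant on $\mathcal X$. Let $(X_1,Y_1),\dots,(X_n,Y_n)$ be i.i.d. with $X_i\sim\mu$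 and $Y_i=f^\star(X_i)+\xi_i$, where the $\xi_i$ are square integrable, $\mathbb E[\xi_i\mid X_1,\dots,X_n]=0$ and $\mathbb E[\xi_i\xi_j\mid X_1,\dots,X_n]=\delta_{ij}$ for all $i,j$. Let $(X,Y)$ be a test pair, independent of the training sample, with $X\sim\mu$, $Y=f^\star(X)+\xi$, $\mathbb E[\xi\mid X]=0$ and $\mathbb E[\xi^2]=1$, and let $R[h]=\mathbb E[(h(X)-Y)^2]$ be the risk of a predictor $h$, taken conditionally on the training sample if $h$ depends on it. Let $f$ minimise $h\mapsto\sum_{i=1}^n(h(X_i)-Y_i)^2+\rho\|h\|_{\mathcal H}^2$ over $\mathcal H$, let $\bar f=\mathcal O f$, and let $\Lambda f^\star$ minimise $h\mapsto\sum_{i=1}^n(h(X_i)-f^\star(X_i))^2+\rho\|h\|_{\mathcal H}^2$ over $\mathcal H$. Let $f'$ be any predictor in $L_2(\mu)$, possibly depending on the training sample (with $R[f']$ a random variable), such that $R[f']\le R[\bar f]$ almost surely. Let $\gamma_1,\dots,\gamma_n$ be the eigenvalues, with multiplicity, of the Gram matrix $K_{ij}=k(X_i,X_j)$, and put $$\zeta_1(\rho)=\mathbb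 E\Big[\sum_{i=1}^n\frac{\gamma_i^2}{(\gamma_i+\rho)^2}\Big],\qquad \zeta_2(\rho)=\mathbb E\Big[\Big(\sum_{i=1}^n\frac{\gamma_i}{\gamma_i+\rho}\Big)^2\Big].$$ Then $R[f]-R[f']$, $\|(\mathrm{id}-\mathcal O)\Lambda f^\star\|_{L_2(\mu)}^2$ and the two random variables defining $\zeta_1,\zeta_2$ are integrable, and $$\mathbb E\big[R[f]-R[f']\big]\ \ge\ \frac{\|\theta\|_2^2\,(d\,\zeta_1(\rho)-\zeta_2(\rho))\,(d-\|\Phi\|_F^2)}{d(d+2)(d-1)}+\frac{d-\|\Phi\|_F^2}{(d\sqrt n+\rho/\sqrt n)^2}.$$ The first term on the right equals the bias term $\mathbb E\big[\|(\mathrm{id}-\mathcal O)\Lambda f^\star\|_{L_2(\mu)}^2\big]$, the second equals the variance term $\|k^\perp\|_{L_2(\mu\otimes\mu)}^2/(\sqrt n\,M_k+\rho/\sqrt n)^2$, both terms are non-negative, and $d-\|\Phi\|_F^2=\dim A$. -/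

import Mathlib

open MeasureTheory ProbabilityTheory
open scoped Matrix

noncomputable section

/-! ## Kernels, orbit averages, kernel ridge regression and risk on a general input space -/

section General

variable {G 𝒳 : Type*} [MeasurableSpace G] [MeasurableSpace 𝒳]

/-- The averaging operator `(𝒪 f)(x) = ∫ f(g x) dλ(g)` for the action `a` of `G` on `𝒳`. -/
def orbitAverage (lam : Measure G) (a : G → 𝒳 → 𝒳) (f : 𝒳 → ℝ) (x : 𝒳) : ℝ :=
  ∫ g, f (a g x) ∂lam

/-- The kernel averaged over its second argument, `k̄(x, y) = ∫ k(x, g y) dλ(g)`. -/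
def kernelAverage (lam : Measure G) (a : G → 𝒳 → 𝒳) (k : 𝒳 → 𝒳 → ℝ) (x y : 𝒳) : ℝ :=
  ∫ g, k x (a g y) ∂lam

/-- `k^⊥ = k - k̄`. -/
def kernelPerp (lam : Measure G) (a : G → 𝒳 → 𝒳) (k : 𝒳 → 𝒳 → ℝ) (x y : 𝒳) : ℝ :=
  k x y - kernelAverage lam a k x y

/-- The squared norm of `j` in `L₂(μ ⊗ μ)`. -/
def kernelL2NormSq (μ : Measure 𝒳) (j : 𝒳 → 𝒳 → ℝ) : ℝ :=
  ∫ p, j p.1 p.2 ^ 2 ∂(μ.prod μ)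

/-- `M_k = sup_x k(x, x)`. -/
def kernelSup {𝒳 : Type*} (k : 𝒳 → 𝒳 → ℝ) : ℝ := ⨆ x, k x x

/-- The Gram matrix `K_{ij} = k(x_i, x_j)`. -/
def kernelGram {𝒳 : Type*} {n : ℕ} (k : 𝒳 → 𝒳 → ℝ) (x : Fin n → 𝒳) : Matrix (Fin n) (Fin n) ℝ :=
  Matrix.of fun i j => k (x i) (x j)

/-- `H` is the reproducing kernel Hilbert space of the real kernel `k`
(the value of Mathlib's kernel at `(x, y)` is an operator on `ℝ`, that is, a number). -/
def HasReproducingKernel {𝒳 : Type*} (H : Type*) [NormedAddCommGroup H] [InnerProductSpace ℝ H]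
    [CompleteSpace H] [RKHS ℝ H 𝒳 ℝ] (k : 𝒳 → 𝒳 → ℝ) : Prop :=
  ∀ x y, RKHS.kernel H x y (1 : ℝ) = k x y

/-- The kernel ridge regression objective `∑ᵢ (h(xᵢ) - yᵢ)² + ρ ‖h‖²_H`. -/
def krrObjective {𝒳 H : Type*} [NormedAddCommGroup H] [InnerProductSpace ℝ H]
    [RKHS ℝ H 𝒳 ℝ] {n : ℕ} (ρ : ℝ) (x : Fin n → 𝒳) (y : Fin n → ℝ) (h : H) : ℝ :=
  ∑ i, (h (x i) - y i) ^ 2 + ρ * ‖h‖ ^ 2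

/-- `h` solves the kernel ridge regression problem on the data `(xᵢ, yᵢ)`. -/
def IsKRRSolution {𝒳 H : Type*} [NormedAddCommGroup H] [InnerProductSpace ℝ H]
    [RKHS ℝ H 𝒳 ℝ] {n : ℕ} (ρ : ℝ) (x : Fin n → 𝒳) (y : Fin n → ℝ) (h : H) : Prop :=
  ∀ h' : H, krrObjective ρ x y h ≤ krrObjective ρ x y h'

/-- The risk `R[h] = E[(h(X) - Y)²]` of a fixed predictor `h` on a test pair `(X, Y)`. For a
predictor that depends on the training sample the risk is taken conditionally on the sample. -/
def risk {Ω : Type*} [MeasurableSpace Ω] {𝒳 : Type*} (P : Measure Ω) (X : Ω → 𝒳) (Y : Ω → ℝ)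
    (h : 𝒳 → ℝ) : ℝ :=
  ∫ ω, (h (X ω) - Y ω) ^ 2 ∂P

/-- `‖(id - 𝒪) h‖²_μ`. -/
def antisymNormSq (μ : Measure 𝒳) (lam : Measure G) (a : G → 𝒳 → 𝒳) (h : 𝒳 → ℝ) : ℝ :=
  ∫ x, (h x - orbitAverage lam a h x) ^ 2 ∂μ

end General

/-! ## The sphere of radius `√d`, the linear kernel and orthogonal representations -/

/-- The sphere of radius `√d` in `ℝᵈ`. -/
abbrev SqrtSphere (d : ℕ) : Type := Metric.sphere (0 : EuclideanSpace ℝ (Fin d)) (√(d : ℝ))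

/-- The dilation of the unit sphere onto the sphere of radius `√d`. -/
def sphereDilation (d : ℕ) (u : Metric.sphere (0 : EuclideanSpace ℝ (Fin d)) 1) : SqrtSphere d :=
  ⟨√(d : ℝ) • (u : EuclideanSpace ℝ (Fin d)), by
    have hu : ‖(u : EuclideanSpace ℝ (Fin d))‖ = 1 := by simp
    simp only [mem_sphere_zero_iff_norm, norm_smul, hu, mul_one, Real.norm_eq_abs]
    exact abs_of_nonneg (Real.sqrt_nonneg _)⟩

/-- The uniform distribution on the sphere of radius `√d`: the normalised surface measure. -/
def uniformSqrtSphere (d : ℕ) : Measure (SqrtSphere d) :=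
  ((volume : Measure (EuclideanSpace ℝ (Fin d))).toSphere Set.univ)⁻¹ •
    ((volume : Measure (EuclideanSpace ℝ (Fin d))).toSphere).map (sphereDilation d)

/-- The linear kernel `k(x, y) = xᵀ y`. -/
def linearKernel (d : ℕ) (x y : SqrtSphere d) : ℝ :=
  inner ℝ (x : EuclideanSpace ℝ (Fin d)) (y : EuclideanSpace ℝ (Fin d))

/-- The linear function `x ↦ θᵀ x` on the sphere. -/
def linearTarget {d : ℕ} (θ : EuclideanSpace ℝ (Fin d)) (x : SqrtSphere d) : ℝ :=
  inner ℝ θ (x : EuclideanSpace ℝ (Fin d))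

lemma isHermitian_kernelGram_linearKernel {d n : ℕ} (x : Fin n → SqrtSphere d) :
    (kernelGram (linearKernel d) x).IsHermitian := by
  ext i j
  simp [kernelGram, linearKernel, real_inner_comm]

lemma norm_toLp_orthogonal_mulVec {d : ℕ} (U : Matrix.orthogonalGroup (Fin d) ℝ)
    (x : EuclideanSpace ℝ (Fin d)) :
    ‖WithLp.toLp 2 ((U : Matrix (Fin d) (Fin d) ℝ) *ᵥ x.ofLp)‖ = ‖x‖ := by
  have h : (U : Matrix (Fin d) (Fin d) ℝ)ᵀ * (U : Matrix (Fin d) (Fin d) ℝ) = 1 := by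
    have := U.2.1
    simpa [Matrix.star_eq_conjTranspose] using this
  have key : ((U : Matrix (Fin d) (Fin d) ℝ) *ᵥ x.ofLp) ⬝ᵥ
      ((U : Matrix (Fin d) (Fin d) ℝ) *ᵥ x.ofLp) = x.ofLp ⬝ᵥ x.ofLp := by
    rw [Matrix.dotProduct_mulVec, Matrix.vecMul_mulVec, h, Matrix.vecMul_one]
  rw [EuclideanSpace.norm_eq, EuclideanSpace.norm_eq]
  congr 1
  simpa [dotProduct, sq] using key

section Representation

variable {G : Type*} [Group G] {d : ℕ}

/-- The action `(g, x) ↦ φ(g) x` on the sphere of an orthogonal representation `φ`. -/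
def sphereAction (φ : G →* Matrix.orthogonalGroup (Fin d) ℝ) (g : G) (x : SqrtSphere d) :
    SqrtSphere d :=
  ⟨WithLp.toLp 2 ((φ g : Matrix (Fin d) (Fin d) ℝ) *ᵥ (x : EuclideanSpace ℝ (Fin d)).ofLp), by
    rw [mem_sphere_zero_iff_norm, norm_toLp_orthogonal_mulVec]
    exact mem_sphere_zero_iff_norm.mp x.2⟩

/-- The matrix `Φ = ∫ φ(g) dλ(g)`, integrated entrywise. -/
def averageMatrix [MeasurableSpace G] (lam : Measure G)
    (φ : G →* Matrix.orthogonalGroup (Fin d) ℝ) : Matrix (Fin d) (Fin d) ℝ :=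
  Matrix.of fun i j => ∫ g, (φ g : Matrix (Fin d) (Fin d) ℝ) i j ∂lam

/-- The squared Frobenius norm. -/
def frobeniusNormSq (M : Matrix (Fin d) (Fin d) ℝ) : ℝ := ∑ i, ∑ j, M i j ^ 2

/-- The subspace `S` of `ℝᵈ` of vectors fixed by `φ`. -/
def symmetricSubspace (φ : G →* Matrix.orthogonalGroup (Fin d) ℝ) :
    Submodule ℝ (EuclideanSpace ℝ (Fin d)) where
  carrier := {w | ∀ g, WithLp.toLp 2 ((φ g : Matrix (Fin d) (Fin d) ℝ) *ᵥ w.ofLp) = w}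
  zero_mem' := by intro g; simp
  add_mem' := by
    intro v w hv hw g
    simp only [Set.mem_ofPred_eq] at hv hw
    rw [WithLp.ofLp_add, Matrix.mulVec_add, WithLp.toLp_add, hv g, hw g]
  smul_mem' := by
    intro c v hv g
    simp only [Set.mem_ofPred_eq] at hv
    rw [WithLp.ofLp_smul, Matrix.mulVec_smul, WithLp.toLp_smul, hv g]

/-- The anti-symmetric subspace `A` of `ℝᵈ`, the orthogonal complement of `S`. -/
def antisymmetricSubspace (φ : G →* Matrix.orthogonalGroup (Fin d) ℝ) :
    Submodule ℝ (EuclideanSpace ℝ (Fin d)) :=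
  (symmetricSubspace φ)ᗮ

end Representation

/-! ## The spectral functions of the Gram matrix -/

/-- The eigenvalues `γ₁, …, γₙ` (with multiplicity) of the Gram matrix of the linear kernel. -/
def gramEigenvalues {d n : ℕ} (x : Fin n → SqrtSphere d) : Fin n → ℝ :=
  (isHermitian_kernelGram_linearKernel x).eigenvalues

/-- `∑ᵢ γᵢ² / (γᵢ + ρ)²`. -/
def spectralSumOne {d n : ℕ} (ρ : ℝ) (x : Fin n → SqrtSphere d) : ℝ :=
  ∑ i, gramEigenvalues x i ^ 2 / (gramEigenvalues x i + ρ) ^ 2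

/-- `(∑ᵢ γᵢ / (γᵢ + ρ))²`. -/
def spectralSumTwo {d n : ℕ} (ρ : ℝ) (x : Fin n → SqrtSphere d) : ℝ :=
  (∑ i, gramEigenvalues x i / (gramEigenvalues x i + ρ)) ^ 2

/-- `ζ₁(ρ) = E[∑ᵢ γᵢ² / (γᵢ + ρ)²]`. -/
def zetaOne {Ω : Type*} [MeasurableSpace Ω] (P : Measure Ω) {d n : ℕ} (X : Fin n → Ω → SqrtSphere d)
    (ρ : ℝ) : ℝ :=
  ∫ ω, spectralSumOne ρ (fun i => X i ω) ∂P

/-- `ζ₂(ρ) = E[(∑ᵢ γᵢ / (γᵢ + ρ))²]`. -/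
def zetaTwo {Ω : Type*} [MeasurableSpace Ω] (P : Measure Ω) {d n : ℕ} (X : Fin n → Ω → SqrtSphere d)
    (ρ : ℝ) : ℝ :=
  ∫ ω, spectralSumTwo ρ (fun i => X i ω) ∂P

end

/-! The ridge solution on data `(x, y)` is the linear function `z ↦ ⟨w, z⟩` with `w = Xᵀ(K + ρ)⁻¹y`,
where `X` has the sample points as rows (`IsKRRSolution.apply_eq`). By isotropy of the sphere a
linear predictor has risk `‖w - θ‖² + 1` (`risk_inner_eq`). Averaging over the group replaces `w` by
its projection onto `S` (`integral_repIsometry`, `orbitAverage_inner`), and invariance of the target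
forces `θ ∈ S`. By Pythagoras, `R[f] - R[𝒪 f]` is the squared norm of the projection of `w` onto
`A`, that is, the sum of `⟨a, w⟩²` over an orthonormal basis of `A`; it has `dim A = d - ‖Φ‖_F²`
terms. Passing from `𝒪 f` to `f'` can only enlarge the gap.

Fix a unit vector `a ∈ A`, so `a ⟂ θ`. Let `B` be the bilinear form of `Xᵀ(K + ρ)⁻¹X` and `c = (K +
ρ)⁻¹Xa`. Then `⟨a, w⟩ = B(a, θ) + ∑ cᵢ ξᵢ`, and the conditional moments of the noise give second
moment `E[B(a, θ)²] + E[∑ cᵢ²]` (`integral_inner_ridgeVector_sq`).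

Bias: the law of the sample is invariant under all linear isometries, so for orthonormal `u, v` the
moments `p = E[B(u,u)²]`, `q = E[B(u,v)²]`, `r = E[B(u,u)B(v,v)]` do not depend on the pair.
Rotating by 45° gives `2q = p - r`, and traces give `ζ₁ = dp + d(d-1)q`, `ζ₂ = dp + d(d-1)r`.
Eliminating, `d ζ₁ - ζ₂ = d(d+2)(d-1)q` (`integral_ridgeForm_sq_of_orthonormal`).

Variance: `(K + ρ)c = Xa` and `K + ρ` has operator norm at most `nd + ρ`, so `‖c‖² ≥ ‖Xa‖²/(nd +
ρ)²`, while `E‖Xa‖² = n`. -/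

/-! ## Rotation invariance and second moments of the uniform distribution on the sphere -/

/-- The action of a linear isometry on the sphere of radius `√d`. -/
noncomputable def sphereIsometry {d : ℕ} (U : EuclideanSpace ℝ (Fin d) ≃ₗᵢ[ℝ] EuclideanSpace ℝ (Fin d))
    (x : SqrtSphere d) : SqrtSphere d :=
  ⟨U x, by simp⟩

@[simp]
lemma coe_sphereIsometry {d : ℕ}
    (U : EuclideanSpace ℝ (Fin d) ≃ₗᵢ[ℝ] EuclideanSpace ℝ (Fin d)) (x : SqrtSphere d) :
    (sphereIsometry U x : EuclideanSpace ℝ (Fin d)) = U x := rfl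

lemma continuous_sphereIsometry {d : ℕ}
    (U : EuclideanSpace ℝ (Fin d) ≃ₗᵢ[ℝ] EuclideanSpace ℝ (Fin d)) :
    Continuous (sphereIsometry U) :=
  (U.continuous.comp continuous_subtype_val).subtype_mk _

lemma continuous_sphereDilation (d : ℕ) : Continuous (sphereDilation d) :=
  (continuous_subtype_val.const_smul (√(d : ℝ))).subtype_mk _

/-- The action of a linear isometry on the unit sphere. -/
noncomputable def unitSphereIsometry {d : ℕ} (U : EuclideanSpace ℝ (Fin d) ≃ₗᵢ[ℝ] EuclideanSpace ℝ (Fin d))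
    (x : Metric.sphere (0 : EuclideanSpace ℝ (Fin d)) 1) :
    Metric.sphere (0 : EuclideanSpace ℝ (Fin d)) 1 :=
  ⟨U x, by simp⟩

-- The surface measure of `s` is a multiple of the volume of the cone `(0,1) • s`; a linear isometry
-- maps cones to cones and preserves volume.
open scoped Pointwise in
lemma measurePreserving_unitSphereIsometry {d : ℕ}
    (U : EuclideanSpace ℝ (Fin d) ≃ₗᵢ[ℝ] EuclideanSpace ℝ (Fin d)) :
    MeasurePreserving (unitSphereIsometry U)
      ((volume : Measure (EuclideanSpace ℝ (Fin d))).toSphere)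
      ((volume : Measure (EuclideanSpace ℝ (Fin d))).toSphere) := by
  have hc : Continuous (unitSphereIsometry U) :=
    (U.continuous.comp continuous_subtype_val).subtype_mk _
  refine ⟨hc.measurable, ?_⟩
  ext s hs
  rw [Measure.map_apply hc.measurable hs, Measure.toSphere_apply' _ (hc.measurable hs),
    Measure.toSphere_apply' _ hs]
  congr 1
  rw [← U.measurePreserving.measure_preimage_emb
    U.toHomeomorph.measurableEmbedding
    (Set.Ioo (0 : ℝ) 1 • ((fun x : Metric.sphere (0 : EuclideanSpace ℝ (Fin d)) 1 =>
      (x : EuclideanSpace ℝ (Fin d))) '' s))]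
  congr 1
  ext z
  simp only [Set.mem_smul, Set.mem_image, Set.mem_preimage]
  constructor
  · rintro ⟨r, hr, _, ⟨x, hx, rfl⟩, rfl⟩
    exact ⟨r, hr, _, ⟨_, hx, rfl⟩, by simp [unitSphereIsometry]⟩
  · rintro ⟨r, hr, _, ⟨x, hx, rfl⟩, h⟩
    refine ⟨r, hr, _, ⟨⟨U.symm x, by simp⟩, ?_, rfl⟩, ?_⟩
    · convert hx
      simp [unitSphereIsometry]
    · apply U.injective
      simp [← h]

instance isProbabilityMeasure_uniformSqrtSphere {d : ℕ} [NeZero d] :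
    IsProbabilityMeasure (uniformSqrtSphere d) := by
  constructor
  have : Nonempty (Fin d) := ⟨0⟩
  have : Nontrivial (EuclideanSpace ℝ (Fin d)) := inferInstance
  rw [uniformSqrtSphere, Measure.smul_apply,
    Measure.map_apply (continuous_sphereDilation d).measurable MeasurableSet.univ, Set.preimage_univ,
    smul_eq_mul]
  refine ENNReal.inv_mul_cancel ?_ (measure_ne_top _ _)
  rw [Ne, Measure.measure_univ_eq_zero]
  exact Measure.toSphere_ne_zero _

lemma measurePreserving_sphereIsometry {d : ℕ}
    (U : EuclideanSpace ℝ (Fin d) ≃ₗᵢ[ℝ] EuclideanSpace ℝ (Fin d)) :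
    MeasurePreserving (sphereIsometry U) (uniformSqrtSphere d) (uniformSqrtSphere d) := by
  refine ⟨(continuous_sphereIsometry U).measurable, ?_⟩
  have hcomm : sphereIsometry U ∘ sphereDilation d = sphereDilation d ∘ unitSphereIsometry U := by
    funext x
    apply Subtype.ext
    simp [sphereDilation, unitSphereIsometry]
  have h := measurePreserving_unitSphereIsometry U
  rw [uniformSqrtSphere, Measure.map_smul,
    Measure.map_map (continuous_sphereIsometry U).measurable (continuous_sphereDilation d).measurable,
    hcomm, ← Measure.map_map (continuous_sphereDilation d).measurable h.measurable, h.map_eq]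

lemma norm_coe_sqrtSphere {d : ℕ} (x : SqrtSphere d) :
    ‖(x : EuclideanSpace ℝ (Fin d))‖ = √(d : ℝ) := by simp

lemma norm_sq_coe_sqrtSphere {d : ℕ} (x : SqrtSphere d) :
    ‖(x : EuclideanSpace ℝ (Fin d))‖ ^ 2 = d := by simp

lemma measurable_inner_sqrtSphere {d : ℕ} (u : EuclideanSpace ℝ (Fin d)) :
    Measurable fun x : SqrtSphere d => inner ℝ u (x : EuclideanSpace ℝ (Fin d)) :=
  (continuous_const.inner continuous_subtype_val).measurable

lemma abs_inner_sqrtSphere_le {d : ℕ} (u : EuclideanSpace ℝ (Fin d)) (x : SqrtSphere d) :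
    |inner ℝ u (x : EuclideanSpace ℝ (Fin d))| ≤ ‖u‖ * √(d : ℝ) := by
  simpa using abs_real_inner_le_norm u (x : EuclideanSpace ℝ (Fin d))

lemma integrable_inner_sq_sqrtSphere {d : ℕ} [NeZero d] (u : EuclideanSpace ℝ (Fin d)) :
    Integrable (fun x : SqrtSphere d => inner ℝ u (x : EuclideanSpace ℝ (Fin d)) ^ 2)
      (uniformSqrtSphere d) := by
  refine Integrable.of_bound ((measurable_inner_sqrtSphere u).pow_const 2).aestronglyMeasurable
    ((‖u‖ * √(d : ℝ)) ^ 2) (.of_forall fun x => ?_)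
  rw [Real.norm_eq_abs, abs_pow]
  exact pow_le_pow_left₀ (abs_nonneg _) (abs_inner_sqrtSphere_le u x) 2

lemma integral_inner_sq_eq_of_norm_eq {d : ℕ} {u v : EuclideanSpace ℝ (Fin d)}
    (h : ‖u‖ = ‖v‖) :
    ∫ x : SqrtSphere d, inner ℝ u (x : EuclideanSpace ℝ (Fin d)) ^ 2 ∂uniformSqrtSphere d =
      ∫ x : SqrtSphere d, inner ℝ v (x : EuclideanSpace ℝ (Fin d)) ^ 2 ∂uniformSqrtSphere d := by
  -- The reflection in the hyperplane orthogonal to `u - v` exchanges `u` and `v`, as their norms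
  -- agree.
  have hU := Submodule.reflection_sub h
  set U := (ℝ ∙ (u - v))ᗮ.reflection
  rw [← (measurePreserving_sphereIsometry U).map_eq, integral_map
    (continuous_sphereIsometry U).aemeasurable
    ((measurable_inner_sqrtSphere v).pow_const 2).aestronglyMeasurable]
  simp only [coe_sphereIsometry]
  rw [(measurePreserving_sphereIsometry U).map_eq]
  simp_rw [← hU, U.inner_map_map]

/-- The uniform distribution on the sphere of radius `√d` is isotropic. -/
theorem integral_inner_sq_uniformSqrtSphere {d : ℕ} [NeZero d] (w : EuclideanSpace ℝ (Fin d)) :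
    ∫ x : SqrtSphere d, inner ℝ w (x : EuclideanSpace ℝ (Fin d)) ^ 2 ∂uniformSqrtSphere d =
      ‖w‖ ^ 2 := by
  let b := EuclideanSpace.basisFun (Fin d) ℝ
  -- Parseval makes the sum of these integrands constant on the sphere; the `d` integrals are equal,
  -- since each vector `‖w‖ • b i` has the norm of `w`.
  have hsum : ∑ i, ∫ x : SqrtSphere d,
      inner ℝ (‖w‖ • b i) (x : EuclideanSpace ℝ (Fin d)) ^ 2 ∂uniformSqrtSphere d =
        ‖w‖ ^ 2 * d := by
    rw [← integral_finsetSum _ fun i _ => integrable_inner_sq_sqrtSphere _]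
    have : ∀ x : SqrtSphere d, ∑ i, inner ℝ (‖w‖ • b i) (x : EuclideanSpace ℝ (Fin d)) ^ 2 =
        ‖w‖ ^ 2 * d := fun x => by
      have h := b.sum_sq_norm_inner_right (x : EuclideanSpace ℝ (Fin d))
      simp only [Real.norm_eq_abs, sq_abs, norm_sq_coe_sqrtSphere] at h
      simp_rw [real_inner_smul_left, mul_pow, ← Finset.mul_sum, h]
    simp [this]
  have heq : ∀ i, ∫ x : SqrtSphere d,
      inner ℝ (‖w‖ • b i) (x : EuclideanSpace ℝ (Fin d)) ^ 2 ∂uniformSqrtSphere d =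
        ∫ x : SqrtSphere d, inner ℝ w (x : EuclideanSpace ℝ (Fin d)) ^ 2 ∂uniformSqrtSphere d :=
    fun i => integral_inner_sq_eq_of_norm_eq (by simp [norm_smul])
  simp_rw [heq] at hsum
  simp only [Finset.sum_const, Finset.card_univ, Fintype.card_fin, nsmul_eq_mul] at hsum
  have hd : (d : ℝ) ≠ 0 := NeZero.ne _
  field_simp at hsum
  exact hsum

/-! ## The resolvent of the Gram matrix -/

section Resolvent

variable {m : Type*} [Fintype m] [DecidableEq m]

/-- Both factors are diagonal in an eigenbasis of `K`, so their product is the function `t ↦ t / (t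
+ ρ)` of `K`. -/
lemma Matrix.IsHermitian.inv_add_smul_one_eq {K : Matrix m m ℝ} (hK : K.IsHermitian) {ρ : ℝ}
    (h : ∀ i, hK.eigenvalues i + ρ ≠ 0) :
    (K + ρ • (1 : Matrix m m ℝ))⁻¹ * K =
      hK.eigenvectorUnitary.1 * Matrix.diagonal
        (fun i => hK.eigenvalues i / (hK.eigenvalues i + ρ)) * star hK.eigenvectorUnitary.1 := by
  set U := hK.eigenvectorUnitary.1 with hUdef
  set γ := hK.eigenvalues
  have hU : star U * U = 1 := Unitary.coe_star_mul_self hK.eigenvectorUnitary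
  have hU' : U * star U = 1 := Unitary.coe_mul_star_self hK.eigenvectorUnitary
  have hspec : K = U * Matrix.diagonal γ * star U := by
    have := hK.spectral_theorem
    rw [Unitary.conjStarAlgAut_apply] at this
    simpa using this
  have hadd : K + ρ • (1 : Matrix m m ℝ) = U * Matrix.diagonal (fun i => γ i + ρ) * star U := by
    have : Matrix.diagonal (fun i => γ i + ρ) = Matrix.diagonal γ + ρ • (1 : Matrix m m ℝ) := by
      ext i j
      by_cases hij : i = j <;> simp [hij, Matrix.diagonal]
    rw [this, mul_add, add_mul, ← hspec]
    simp [hU']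
  have hinv : (K + ρ • (1 : Matrix m m ℝ))⁻¹ =
      U * Matrix.diagonal (fun i => (γ i + ρ)⁻¹) * star U := by
    apply Matrix.inv_eq_left_inv
    rw [hadd]
    calc _ = U * Matrix.diagonal (fun i => (γ i + ρ)⁻¹) * (star U * U) *
          Matrix.diagonal (fun i => γ i + ρ) * star U := by simp only [mul_assoc]
      _ = 1 := by
        rw [hU, mul_one, mul_assoc U, Matrix.diagonal_mul_diagonal]
        simp [inv_mul_cancel₀ (h _), hU']
  rw [hinv]
  conv_lhs => rw [hspec]
  calc _ = U * Matrix.diagonal (fun i => (γ i + ρ)⁻¹) * (star U * U) *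
          Matrix.diagonal γ * star U := by simp only [mul_assoc]
    _ = _ := by
      rw [hU, mul_one, mul_assoc U, Matrix.diagonal_mul_diagonal]
      simp [div_eq_inv_mul]

lemma Matrix.IsHermitian.trace_inv_add_smul_one_mul {K : Matrix m m ℝ} (hK : K.IsHermitian)
    {ρ : ℝ} (h : ∀ i, hK.eigenvalues i + ρ ≠ 0) :
    ((K + ρ • (1 : Matrix m m ℝ))⁻¹ * K).trace =
      ∑ i, hK.eigenvalues i / (hK.eigenvalues i + ρ) := by
  rw [hK.inv_add_smul_one_eq h, Matrix.trace_mul_comm, ← mul_assoc,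
    Unitary.coe_star_mul_self hK.eigenvectorUnitary, one_mul, Matrix.trace_diagonal]

lemma Matrix.IsHermitian.trace_inv_add_smul_one_mul_sq {K : Matrix m m ℝ} (hK : K.IsHermitian)
    {ρ : ℝ} (h : ∀ i, hK.eigenvalues i + ρ ≠ 0) :
    ((K + ρ • (1 : Matrix m m ℝ))⁻¹ * K * ((K + ρ • (1 : Matrix m m ℝ))⁻¹ * K)).trace =
      ∑ i, hK.eigenvalues i ^ 2 / (hK.eigenvalues i + ρ) ^ 2 := by
  have hU := Unitary.coe_star_mul_self hK.eigenvectorUnitary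
  rw [hK.inv_add_smul_one_eq h]
  set U := hK.eigenvectorUnitary.1
  set D := Matrix.diagonal (fun i => hK.eigenvalues i / (hK.eigenvalues i + ρ))
  calc _ = (U * (D * (star U * U) * D) * star U).trace := by simp only [mul_assoc]
    _ = (D * D).trace := by
      rw [hU, mul_one, Matrix.trace_mul_comm, ← mul_assoc, hU, one_mul]
    _ = _ := by
      rw [Matrix.diagonal_mul_diagonal, Matrix.trace_diagonal]
      exact Finset.sum_congr rfl fun i _ => by rw [← sq, div_pow]

end Resolvent

/-! ### Ridge regression with the linear kernel: coefficients, bilinear form and spectral sums. -/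

section Ridge

variable {d n : ℕ}

/-- The matrix whose rows are the sample points. -/
def sampleMatrix (x : Fin n → SqrtSphere d) : Matrix (Fin n) (Fin d) ℝ :=
  Matrix.of fun i a => (x i : EuclideanSpace ℝ (Fin d)) a

lemma kernelGram_linearKernel_eq (x : Fin n → SqrtSphere d) :
    kernelGram (linearKernel d) x = sampleMatrix x * (sampleMatrix x)ᵀ := by
  ext i j
  simp [kernelGram, linearKernel, sampleMatrix, Matrix.mul_apply, PiLp.inner_apply, mul_comm]

lemma posSemidef_kernelGram_linearKernel (x : Fin n → SqrtSphere d) :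
    (kernelGram (linearKernel d) x).PosSemidef := by
  rw [kernelGram_linearKernel_eq]
  exact Matrix.posSemidef_self_mul_conjTranspose _

lemma gramEigenvalues_nonneg (x : Fin n → SqrtSphere d) (i : Fin n) : 0 ≤ gramEigenvalues x i :=
  (posSemidef_kernelGram_linearKernel x).eigenvalues_nonneg i

/-- The inverse `(K + ρ)⁻¹` of the regularised Gram matrix. -/
noncomputable def gramResolvent (ρ : ℝ) (x : Fin n → SqrtSphere d) : Matrix (Fin n) (Fin n) ℝ :=
  (kernelGram (linearKernel d) x + ρ • (1 : Matrix (Fin n) (Fin n) ℝ))⁻¹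

lemma isUnit_det_gram_add {ρ : ℝ} (hρ : 0 < ρ) (x : Fin n → SqrtSphere d) :
    IsUnit (kernelGram (linearKernel d) x + ρ • (1 : Matrix (Fin n) (Fin n) ℝ)).det := by
  have h1 : (ρ • (1 : Matrix (Fin n) (Fin n) ℝ)).PosDef := Matrix.PosDef.one.smul hρ
  exact (Matrix.PosDef.posSemidef_add (posSemidef_kernelGram_linearKernel x) h1).det_pos.ne'.isUnit

lemma gram_add_mul_gramResolvent {ρ : ℝ} (hρ : 0 < ρ) (x : Fin n → SqrtSphere d) :
    (kernelGram (linearKernel d) x + ρ • (1 : Matrix (Fin n) (Fin n) ℝ)) * gramResolvent ρ x = 1 :=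
  Matrix.mul_nonsing_inv _ (isUnit_det_gram_add hρ x)

lemma transpose_gramResolvent (ρ : ℝ) (x : Fin n → SqrtSphere d) :
    (gramResolvent ρ x)ᵀ = gramResolvent ρ x := by
  have h : (kernelGram (linearKernel d) x)ᵀ = kernelGram (linearKernel d) x := by
    ext i j
    simp [kernelGram, linearKernel, real_inner_comm]
  rw [gramResolvent, Matrix.transpose_nonsing_inv]
  simp [h]

lemma gramResolvent_comm (ρ : ℝ) (x : Fin n → SqrtSphere d) (i j : Fin n) :
    gramResolvent ρ x i j = gramResolvent ρ x j i := by
  conv_lhs => rw [← transpose_gramResolvent]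
  rfl

/-- The determinant never vanishes, so the adjugate formula applies. As the sample space is compact,
every quantity built from the resolvent is then bounded and integrable. -/
lemma continuous_gramResolvent {ρ : ℝ} (hρ : 0 < ρ) :
    Continuous (gramResolvent ρ : (Fin n → SqrtSphere d) → Matrix (Fin n) (Fin n) ℝ) := by
  have hK : Continuous fun x : Fin n → SqrtSphere d =>
      kernelGram (linearKernel d) x + ρ • (1 : Matrix (Fin n) (Fin n) ℝ) := by
    refine Continuous.add (continuous_matrix fun i j => ?_) continuous_const
    simp only [kernelGram, linearKernel, Matrix.of_apply]
    fun_prop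
  have heq : (gramResolvent ρ : (Fin n → SqrtSphere d) → Matrix (Fin n) (Fin n) ℝ) = fun x =>
      (kernelGram (linearKernel d) x + ρ • (1 : Matrix (Fin n) (Fin n) ℝ)).det⁻¹ •
        (kernelGram (linearKernel d) x + ρ • (1 : Matrix (Fin n) (Fin n) ℝ)).adjugate := by
    funext x
    rw [gramResolvent, Matrix.inv_def, Ring.inverse_eq_inv]
  rw [heq]
  exact (hK.matrix_det.inv₀ fun x => (isUnit_det_gram_add hρ x).ne_zero).smul hK.matrix_adjugate

/-- The coefficients `cᵢ` with `⟨u, w⟩ = ∑ᵢ cᵢ yᵢ` for the ridge regression vector `w`. -/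
noncomputable def ridgeCoeff (ρ : ℝ) (x : Fin n → SqrtSphere d) (u : EuclideanSpace ℝ (Fin d))
    (i : Fin n) : ℝ :=
  ∑ j, inner ℝ u (x j : EuclideanSpace ℝ (Fin d)) * gramResolvent ρ x j i

/-- The bilinear form of the matrix `Xᵀ (K + ρ)⁻¹ X`. -/
noncomputable def ridgeForm (ρ : ℝ) (x : Fin n → SqrtSphere d) (u v : EuclideanSpace ℝ (Fin d)) :
    ℝ :=
  ∑ i, ridgeCoeff ρ x u i * inner ℝ v (x i : EuclideanSpace ℝ (Fin d))

/-- The coefficient vector `Xᵀ (K + ρ)⁻¹ y` of the ridge regression solution. -/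
noncomputable def ridgeVector (ρ : ℝ) (x : Fin n → SqrtSphere d) (y : Fin n → ℝ) :
    EuclideanSpace ℝ (Fin d) :=
  ∑ j, (gramResolvent ρ x *ᵥ y) j • (x j : EuclideanSpace ℝ (Fin d))

lemma inner_ridgeVector (ρ : ℝ) (x : Fin n → SqrtSphere d) (y : Fin n → ℝ)
    (u : EuclideanSpace ℝ (Fin d)) :
    inner ℝ u (ridgeVector ρ x y) = ∑ i, ridgeCoeff ρ x u i * y i := by
  simp only [ridgeVector, ridgeCoeff, inner_sum, real_inner_smul_right, Matrix.mulVec, dotProduct,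
    Finset.sum_mul]
  rw [Finset.sum_comm]
  refine Finset.sum_congr rfl fun i _ => Finset.sum_congr rfl fun j _ => by ring

lemma continuous_ridgeCoeff {ρ : ℝ} (hρ : 0 < ρ) (u : EuclideanSpace ℝ (Fin d)) (i : Fin n) :
    Continuous fun x : Fin n → SqrtSphere d => ridgeCoeff ρ x u i :=
  continuous_finsetSum _ fun j _ =>
    (continuous_const.inner (continuous_subtype_val.comp (continuous_apply j))).mul
      ((continuous_gramResolvent hρ).matrix_elem j i)

lemma continuous_ridgeForm {ρ : ℝ} (hρ : 0 < ρ) (u v : EuclideanSpace ℝ (Fin d)) :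
    Continuous fun x : Fin n → SqrtSphere d => ridgeForm ρ x u v :=
  continuous_finsetSum _ fun i _ => (continuous_ridgeCoeff hρ u i).mul
    (continuous_const.inner (continuous_subtype_val.comp (continuous_apply i)))

lemma ridgeForm_comm (ρ : ℝ) (x : Fin n → SqrtSphere d) (u v : EuclideanSpace ℝ (Fin d)) :
    ridgeForm ρ x u v = ridgeForm ρ x v u := by
  simp only [ridgeForm, ridgeCoeff, Finset.sum_mul]
  rw [Finset.sum_comm]
  refine Finset.sum_congr rfl fun i _ => Finset.sum_congr rfl fun j _ => ?_
  rw [gramResolvent_comm]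
  ring

lemma ridgeForm_add_right (ρ : ℝ) (x : Fin n → SqrtSphere d) (u v w : EuclideanSpace ℝ (Fin d)) :
    ridgeForm ρ x u (v + w) = ridgeForm ρ x u v + ridgeForm ρ x u w := by
  simp only [ridgeForm, inner_add_left, mul_add, Finset.sum_add_distrib]

lemma ridgeForm_smul_right (ρ : ℝ) (x : Fin n → SqrtSphere d) (c : ℝ)
    (u v : EuclideanSpace ℝ (Fin d)) :
    ridgeForm ρ x u (c • v) = c * ridgeForm ρ x u v := by
  simp only [ridgeForm, real_inner_smul_left, Finset.mul_sum]
  exact Finset.sum_congr rfl fun i _ => by ring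

/-- The Gram matrix sees only inner products, so rotating the whole sample leaves the resolvent
unchanged. -/
lemma ridgeForm_sphereIsometry (ρ : ℝ) (x : Fin n → SqrtSphere d)
    (U : EuclideanSpace ℝ (Fin d) ≃ₗᵢ[ℝ] EuclideanSpace ℝ (Fin d))
    (u v : EuclideanSpace ℝ (Fin d)) :
    ridgeForm ρ (fun i => sphereIsometry U (x i)) (U u) (U v) = ridgeForm ρ x u v := by
  have hK : kernelGram (linearKernel d) (fun i => sphereIsometry U (x i)) =
      kernelGram (linearKernel d) x := by
    ext i j
    simp [kernelGram, linearKernel]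
  simp [ridgeForm, ridgeCoeff, gramResolvent, hK]

lemma ridgeForm_basisFun (ρ : ℝ) (x : Fin n → SqrtSphere d) (a b : Fin d) :
    ridgeForm ρ x (EuclideanSpace.basisFun (Fin d) ℝ a) (EuclideanSpace.basisFun (Fin d) ℝ b) =
      ((sampleMatrix x)ᵀ * gramResolvent ρ x * sampleMatrix x) a b := by
  simp [ridgeForm, ridgeCoeff, Matrix.mul_apply, sampleMatrix, EuclideanSpace.inner_single_left]

/-- Cyclicity of the trace turns the `n × n` trace of `(K + ρ)⁻¹XXᵀ` into the `d × d` trace of `Xᵀ(K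
+ ρ)⁻¹X`. -/
lemma sum_gramEigenvalues_div {ρ : ℝ} (hρ : 0 < ρ) (x : Fin n → SqrtSphere d) :
    ∑ i, gramEigenvalues x i / (gramEigenvalues x i + ρ) =
      ∑ a, ridgeForm ρ x (EuclideanSpace.basisFun (Fin d) ℝ a)
        (EuclideanSpace.basisFun (Fin d) ℝ a) := by
  have h := (isHermitian_kernelGram_linearKernel x).trace_inv_add_smul_one_mul (ρ := ρ)
    fun i => (add_pos_of_nonneg_of_pos (gramEigenvalues_nonneg x i) hρ).ne'
  simp_rw [ridgeForm_basisFun]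
  change _ = ((sampleMatrix x)ᵀ * gramResolvent ρ x * sampleMatrix x).trace
  rw [Matrix.mul_assoc, Matrix.trace_mul_comm, Matrix.mul_assoc, ← kernelGram_linearKernel_eq]
  exact h.symm

/-- The ridge form is symmetric, so its squared entries add up to the trace of its square, which
cyclicity carries back to the Gram side. -/
lemma spectralSumOne_eq {ρ : ℝ} (hρ : 0 < ρ) (x : Fin n → SqrtSphere d) :
    spectralSumOne ρ x =
      ∑ a, ∑ b, ridgeForm ρ x (EuclideanSpace.basisFun (Fin d) ℝ a)
        (EuclideanSpace.basisFun (Fin d) ℝ b) ^ 2 := by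
  have h := (isHermitian_kernelGram_linearKernel x).trace_inv_add_smul_one_mul_sq (ρ := ρ)
    fun i => (add_pos_of_nonneg_of_pos (gramEigenvalues_nonneg x i) hρ).ne'
  have hsq : ∀ a b, ridgeForm ρ x (EuclideanSpace.basisFun (Fin d) ℝ a)
        (EuclideanSpace.basisFun (Fin d) ℝ b) ^ 2 =
      ((sampleMatrix x)ᵀ * gramResolvent ρ x * sampleMatrix x) a b *
      ((sampleMatrix x)ᵀ * gramResolvent ρ x * sampleMatrix x) b a := fun a b => by
    rw [← ridgeForm_basisFun, ← ridgeForm_basisFun, ridgeForm_comm ρ x _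
      (EuclideanSpace.basisFun (Fin d) ℝ a), sq]
  simp_rw [hsq, ← Matrix.mul_apply]
  change _ = (((sampleMatrix x)ᵀ * gramResolvent ρ x * sampleMatrix x) *
    ((sampleMatrix x)ᵀ * gramResolvent ρ x * sampleMatrix x)).trace
  have e1 : ((sampleMatrix x)ᵀ * gramResolvent ρ x * sampleMatrix x) *
      ((sampleMatrix x)ᵀ * gramResolvent ρ x * sampleMatrix x) =
      (sampleMatrix x)ᵀ * (gramResolvent ρ x * (sampleMatrix x * (sampleMatrix x)ᵀ) *
        gramResolvent ρ x * sampleMatrix x) := by simp only [Matrix.mul_assoc]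
  rw [e1, Matrix.trace_mul_comm, Matrix.mul_assoc, Matrix.mul_assoc (_ * _),
    ← kernelGram_linearKernel_eq]
  exact h.symm

lemma abs_kernelGram_linearKernel_le (x : Fin n → SqrtSphere d) (i j : Fin n) :
    |kernelGram (linearKernel d) x i j| ≤ d := by
  have h := abs_real_inner_le_norm (x i : EuclideanSpace ℝ (Fin d)) (x j)
  rw [norm_coe_sqrtSphere, norm_coe_sqrtSphere, Real.mul_self_sqrt (Nat.cast_nonneg d)] at h
  exact h

/-- Entries of `K` are at most `d` in absolute value, so Cauchy–Schwarz bounds `‖Ke‖²` by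
`(nd)²‖e‖²` and `⟨Ke, e⟩` by `nd‖e‖²`; expanding the square gives the factor `(nd + ρ)²`. -/
lemma sum_sq_gram_add_mulVec_le {ρ : ℝ} (hρ : 0 < ρ) (x : Fin n → SqrtSphere d)
    (e : Fin n → ℝ) :
    ∑ i, ((kernelGram (linearKernel d) x + ρ • (1 : Matrix (Fin n) (Fin n) ℝ)) *ᵥ e) i ^ 2 ≤
      (n * d + ρ) ^ 2 * ∑ i, e i ^ 2 := by
  have hd : (0 : ℝ) ≤ d := Nat.cast_nonneg d
  have hn : (0 : ℝ) ≤ n := Nat.cast_nonneg n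
  set K := kernelGram (linearKernel d) x
  set s := ∑ i, |e i|
  have hs : s ^ 2 ≤ n * ∑ i, e i ^ 2 := by
    have := sq_sum_le_card_mul_sum_sq (s := Finset.univ) (f := fun i => |e i|)
    simpa using this
  have hs0 : 0 ≤ s := Finset.sum_nonneg fun i _ => abs_nonneg _
  have hKe : ∀ i, |(K *ᵥ e) i| ≤ d * s := fun i => by
    rw [Matrix.mulVec, dotProduct, Finset.mul_sum]
    refine (Finset.abs_sum_le_sum_abs _ _).trans (Finset.sum_le_sum fun j _ => ?_)
    rw [abs_mul]
    exact mul_le_mul_of_nonneg_right (abs_kernelGram_linearKernel_le x i j) (abs_nonneg _)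
  have h1 : ∑ i, (K *ᵥ e) i ^ 2 ≤ n * (d * s) ^ 2 := by
    have := Finset.sum_le_card_nsmul Finset.univ (fun i => (K *ᵥ e) i ^ 2) ((d * s) ^ 2)
      fun i _ => by
        rw [← sq_abs]
        exact pow_le_pow_left₀ (abs_nonneg _) (hKe i) 2
    simpa using this
  have h2 : ∑ i, (K *ᵥ e) i * e i ≤ d * s ^ 2 := by
    calc ∑ i, (K *ᵥ e) i * e i ≤ ∑ i, d * s * |e i| := Finset.sum_le_sum fun i _ => by
          refine (le_abs_self _).trans ?_
          rw [abs_mul]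
          exact mul_le_mul_of_nonneg_right (hKe i) (abs_nonneg _)
      _ = d * s ^ 2 := by rw [← Finset.mul_sum]; ring
  have hexp : ∑ i, ((K + ρ • (1 : Matrix (Fin n) (Fin n) ℝ)) *ᵥ e) i ^ 2 =
      ∑ i, (K *ᵥ e) i ^ 2 + 2 * ρ * ∑ i, (K *ᵥ e) i * e i + ρ ^ 2 * ∑ i, e i ^ 2 := by
    rw [Finset.mul_sum, Finset.mul_sum, ← Finset.sum_add_distrib, ← Finset.sum_add_distrib]
    refine Finset.sum_congr rfl fun i _ => ?_
    simp only [Matrix.add_mulVec, Matrix.smul_mulVec, Matrix.one_mulVec, Pi.add_apply,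
      Pi.smul_apply, smul_eq_mul]
    ring
  rw [hexp]
  have h3 : (n : ℝ) * (d * s) ^ 2 ≤ n * (d ^ 2 * (n * ∑ i, e i ^ 2)) := by
    rw [mul_pow]
    gcongr
  have h4 : 2 * ρ * ∑ i, (K *ᵥ e) i * e i ≤ 2 * ρ * (d * (n * ∑ i, e i ^ 2)) := by
    gcongr
    exact h2.trans (by gcongr)
  linarith

/-- The coefficients `c` solve `(K + ρ)c = Xu`, so an upper bound on `K + ρ` is a lower bound on
`‖c‖`. This drives the variance estimate. -/
lemma sum_inner_sq_le_ridgeCoeff {ρ : ℝ} (hρ : 0 < ρ) (x : Fin n → SqrtSphere d)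
    (u : EuclideanSpace ℝ (Fin d)) :
    ∑ i, inner ℝ u (x i : EuclideanSpace ℝ (Fin d)) ^ 2 ≤
      (n * d + ρ) ^ 2 * ∑ i, ridgeCoeff ρ x u i ^ 2 := by
  have hc : ridgeCoeff ρ x u = gramResolvent ρ x *ᵥ fun j =>
      inner ℝ u (x j : EuclideanSpace ℝ (Fin d)) := by
    funext i
    simp only [ridgeCoeff, Matrix.mulVec, dotProduct]
    exact Finset.sum_congr rfl fun j _ => by rw [gramResolvent_comm, mul_comm]
  have h := sum_sq_gram_add_mulVec_le hρ x (ridgeCoeff ρ x u)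
  rw [hc, Matrix.mulVec_mulVec, gram_add_mul_gramResolvent hρ, Matrix.one_mulVec] at h
  rwa [hc]

end Ridge

/-! ## The representer theorem for the linear kernel -/

/-- Completing the square around the kernel expansion `h₀` shows that any other element has a
strictly larger objective, so a minimiser must be `h₀`. -/
theorem IsKRRSolution.apply_eq {d n : ℕ} {H : Type*} [NormedAddCommGroup H]
    [InnerProductSpace ℝ H] [CompleteSpace H] [RKHS ℝ H (SqrtSphere d) ℝ]
    (hH : HasReproducingKernel H (linearKernel d)) {ρ : ℝ} (hρ : 0 < ρ)
    {x : Fin n → SqrtSphere d} {y : Fin n → ℝ} {h : H} (hh : IsKRRSolution ρ x y h)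
    (z : SqrtSphere d) :
    h z = inner ℝ (ridgeVector ρ x y) (z : EuclideanSpace ℝ (Fin d)) := by
  set α := gramResolvent ρ x *ᵥ y with hα
  let h₀ : H := ∑ j, α j • RKHS.kerFun H (x j) (1 : ℝ)
  have hinner : ∀ g : H, inner ℝ h₀ g = ∑ j, α j * g (x j) := fun g => by
    simp only [h₀, sum_inner, real_inner_smul_left, RKHS.kerFun_inner]
    simp
  have happly : ∀ z, h₀ z = ∑ j, α j * linearKernel d (x j) z := fun z => by
    have h1 : inner ℝ h₀ (RKHS.kerFun H z (1 : ℝ)) = h₀ z := by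
      rw [RKHS.inner_kerFun]
      simp
    rw [← h1, hinner]
    refine Finset.sum_congr rfl fun j _ => ?_
    rw [RKHS.kerFun_apply, hH]
  -- This is `(K + ρ)α = y`, since `h₀` takes the values `Kα` on the sample.
  have hres : ∀ i, h₀ (x i) - y i = -ρ * α i := fun i => by
    have h1 := congrFun (congrArg (· *ᵥ y) (gram_add_mul_gramResolvent hρ x)) i
    simp only [← Matrix.mulVec_mulVec, Matrix.one_mulVec] at h1
    rw [← hα] at h1
    simp only [Matrix.add_mulVec, Matrix.smul_mulVec, Matrix.one_mulVec, Pi.add_apply,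
      Pi.smul_apply, smul_eq_mul] at h1
    have h2 : h₀ (x i) = (kernelGram (linearKernel d) x *ᵥ α) i := by
      rw [happly]
      simp only [Matrix.mulVec, dotProduct, kernelGram, Matrix.of_apply]
      refine Finset.sum_congr rfl fun j _ => ?_
      rw [mul_comm, linearKernel, linearKernel, real_inner_comm]
    rw [h2]
    linarith
  -- The linear terms cancel: the residuals `-ρα` against the values of `h - h₀` are opposite to
  -- `ρ⟨h₀, h - h₀⟩`, by the reproducing property.
  have key : krrObjective ρ x y h = krrObjective ρ x y h₀ +
      ∑ i, (h - h₀) (x i) ^ 2 + ρ * ‖h - h₀‖ ^ 2 := by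
    have hn : ‖h‖ ^ 2 = ‖h₀‖ ^ 2 + 2 * inner ℝ h₀ (h - h₀) + ‖h - h₀‖ ^ 2 := by
      have := norm_add_sq_real h₀ (h - h₀)
      rwa [add_sub_cancel] at this
    have hcross : ∑ i, (h (x i) - y i) ^ 2 =
        ∑ i, (h₀ (x i) - y i) ^ 2 + ∑ i, (h - h₀) (x i) ^ 2
          + 2 * (-ρ * ∑ i, α i * (h - h₀) (x i)) := by
      simp only [Finset.mul_sum, ← Finset.sum_add_distrib]
      refine Finset.sum_congr rfl fun i _ => ?_
      have e : h (x i) - y i = (h₀ (x i) - y i) + (h - h₀) (x i) := by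
        rw [RKHS.coe_sub, Pi.sub_apply]
        ring
      rw [e, add_sq]
      nth_rewrite 2 [hres i]
      ring
    simp only [krrObjective]
    rw [hn, hcross, hinner]
    ring
  have hle := hh h₀
  rw [key] at hle
  have hpos : 0 ≤ ∑ i, (h - h₀) (x i) ^ 2 := Finset.sum_nonneg fun i _ => sq_nonneg _
  have hzero : ‖h - h₀‖ ^ 2 ≤ 0 := by
    by_contra hc
    have := mul_pos hρ (not_le.mp hc)
    linarith
  have heq : h = h₀ := by
    have := pow_eq_zero_iff (two_ne_zero) |>.mp (le_antisymm hzero (sq_nonneg _))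
    exact sub_eq_zero.mp (norm_eq_zero.mp this)
  rw [heq, happly, ridgeVector, sum_inner]
  exact Finset.sum_congr rfl fun j _ => by rw [real_inner_smul_left]; rfl

/-! ## Fourth-order isotropy of the ridge form -/

/-- Two reflections suffice: one sends `u` to `u'`, the next sends the image of `v` to `v'`. The
second fixes `u'` because both its endpoints are orthogonal to `u'`. -/
lemma exists_linearIsometryEquiv_pair {E : Type*} [NormedAddCommGroup E] [InnerProductSpace ℝ E]
    {u v u' v' : E} (hu : ‖u‖ = ‖u'‖) (hv : ‖v‖ = ‖v'‖) (huv : inner ℝ u v = 0)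
    (huv' : inner ℝ u' v' = 0) : ∃ U : E ≃ₗᵢ[ℝ] E, U u = u' ∧ U v = v' := by
  set R := (ℝ ∙ (u - u'))ᗮ.reflection
  have hR : R u = u' := Submodule.reflection_sub hu
  have hvR : ‖R v‖ = ‖v'‖ := by rw [R.norm_map, hv]
  set T := (ℝ ∙ (R v - v'))ᗮ.reflection
  have hT : T (R v) = v' := Submodule.reflection_sub hvR
  have hTu : T u' = u' := by
    apply Submodule.reflection_mem_subspace_eq_self
    rw [Submodule.mem_orthogonal_singleton_iff_inner_left, inner_sub_right, huv', sub_zero, ← hR,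
      R.inner_map_map, huv]
  exact ⟨R.trans T, by simp [hR, hTu], by simp [hT]⟩

section Moments

variable {d n : ℕ}

/-- The law of an i.i.d. uniform sample on the sphere of radius `√d`. -/
noncomputable def uniformSample (d n : ℕ) : Measure (Fin n → SqrtSphere d) :=
  Measure.pi fun _ => uniformSqrtSphere d

instance isProbabilityMeasure_uniformSample [NeZero d] :
    IsProbabilityMeasure (uniformSample d n) := by
  unfold uniformSample
  infer_instance

lemma Continuous.integrable_of_compactSpace {α : Type*} [TopologicalSpace α] [CompactSpace α]
    [MeasurableSpace α] [OpensMeasurableSpace α] {μ : Measure α} [IsFiniteMeasure μ] {F : α → ℝ}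
    (hF : Continuous F) : Integrable F μ :=
  hF.integrable_of_hasCompactSupport (HasCompactSupport.of_compactSpace F)

lemma measurePreserving_sphereIsometry_pi [NeZero d]
    (U : EuclideanSpace ℝ (Fin d) ≃ₗᵢ[ℝ] EuclideanSpace ℝ (Fin d)) :
    MeasurePreserving (fun (x : Fin n → SqrtSphere d) i => sphereIsometry U (x i))
      (uniformSample d n) (uniformSample d n) :=
  measurePreserving_pi _ _ fun _ => measurePreserving_sphereIsometry U

lemma integral_uniformSample_sphereIsometry [NeZero d]
    (U : EuclideanSpace ℝ (Fin d) ≃ₗᵢ[ℝ] EuclideanSpace ℝ (Fin d))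
    {F : (Fin n → SqrtSphere d) → ℝ} (hF : Continuous F) :
    ∫ x, F (fun i => sphereIsometry U (x i)) ∂uniformSample d n = ∫ x, F x ∂uniformSample d n := by
  have h := measurePreserving_sphereIsometry_pi (n := n) U
  conv_rhs => rw [← h.map_eq]
  rw [integral_map h.measurable.aemeasurable hF.aestronglyMeasurable]

lemma continuous_spectralSumOne {ρ : ℝ} (hρ : 0 < ρ) :
    Continuous (spectralSumOne ρ : (Fin n → SqrtSphere d) → ℝ) := by
  simp_rw [funext (spectralSumOne_eq (d := d) (n := n) hρ)]
  exact continuous_finsetSum _ fun a _ => continuous_finsetSum _ fun b _ =>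
    (continuous_ridgeForm hρ _ _).pow 2

lemma spectralSumTwo_eq {ρ : ℝ} (hρ : 0 < ρ) (x : Fin n → SqrtSphere d) :
    spectralSumTwo ρ x =
      ∑ a, ∑ b, ridgeForm ρ x (EuclideanSpace.basisFun (Fin d) ℝ a)
        (EuclideanSpace.basisFun (Fin d) ℝ a) * ridgeForm ρ x (EuclideanSpace.basisFun (Fin d) ℝ b)
        (EuclideanSpace.basisFun (Fin d) ℝ b) := by
  rw [spectralSumTwo, sum_gramEigenvalues_div hρ, sq, Finset.sum_mul_sum]

lemma continuous_spectralSumTwo {ρ : ℝ} (hρ : 0 < ρ) :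
    Continuous (spectralSumTwo ρ : (Fin n → SqrtSphere d) → ℝ) := by
  simp_rw [funext (spectralSumTwo_eq (d := d) (n := n) hρ)]
  exact continuous_finsetSum _ fun a _ => continuous_finsetSum _ fun b _ =>
    (continuous_ridgeForm hρ _ _).mul (continuous_ridgeForm hρ _ _)

variable [NeZero d] {ρ : ℝ}

lemma integral_ridgeForm_sq_congr (hρ : 0 < ρ) {u v u' v' : EuclideanSpace ℝ (Fin d)}
    (hu : ‖u‖ = ‖u'‖) (hv : ‖v‖ = ‖v'‖) (huv : inner ℝ u v = 0) (huv' : inner ℝ u' v' = 0) :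
    ∫ x, ridgeForm ρ x u v ^ 2 ∂uniformSample d n =
      ∫ x, ridgeForm ρ x u' v' ^ 2 ∂uniformSample d n := by
  obtain ⟨U, rfl, rfl⟩ := exists_linearIsometryEquiv_pair hu hv huv huv'
  rw [← integral_uniformSample_sphereIsometry U (F := fun x => ridgeForm ρ x (U u) (U v) ^ 2)
    ((continuous_ridgeForm hρ _ _).pow 2)]
  simp_rw [ridgeForm_sphereIsometry]

lemma integral_ridgeForm_mul_congr (hρ : 0 < ρ) {u v u' v' : EuclideanSpace ℝ (Fin d)}
    (hu : ‖u‖ = ‖u'‖) (hv : ‖v‖ = ‖v'‖) (huv : inner ℝ u v = 0) (huv' : inner ℝ u' v' = 0) :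
    ∫ x, ridgeForm ρ x u u * ridgeForm ρ x v v ∂uniformSample d n =
      ∫ x, ridgeForm ρ x u' u' * ridgeForm ρ x v' v' ∂uniformSample d n := by
  obtain ⟨U, rfl, rfl⟩ := exists_linearIsometryEquiv_pair hu hv huv huv'
  rw [← integral_uniformSample_sphereIsometry U
    (F := fun x => ridgeForm ρ x (U u) (U u) * ridgeForm ρ x (U v) (U v))
    ((continuous_ridgeForm hρ _ _).mul (continuous_ridgeForm hρ _ _))]
  simp_rw [ridgeForm_sphereIsometry]

lemma integral_ridgeForm_self_sq_congr (hρ : 0 < ρ) {u u' : EuclideanSpace ℝ (Fin d)}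
    (hu : ‖u‖ = ‖u'‖) :
    ∫ x, ridgeForm ρ x u u ^ 2 ∂uniformSample d n =
      ∫ x, ridgeForm ρ x u' u' ^ 2 ∂uniformSample d n := by
  -- Zero serves as the second vector of each pair, since only one vector has to be moved.
  obtain ⟨U, rfl, -⟩ := exists_linearIsometryEquiv_pair hu (v := 0) (v' := 0) (by simp) (by simp)
    (by simp)
  rw [← integral_uniformSample_sphereIsometry U (F := fun x => ridgeForm ρ x (U u) (U u) ^ 2)
    ((continuous_ridgeForm hρ _ _).pow 2)]
  simp_rw [ridgeForm_sphereIsometry]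

/-- The pair `(u ± v)/√2` is again orthogonal with the same norms, and symmetry of the form gives it
the value `(B(u,u) - B(v,v))/2`. Squaring and using `E[B(u,u)²] = E[B(v,v)²]` yields the relation.
-/
lemma two_mul_integral_ridgeForm_sq (hρ : 0 < ρ) {u v : EuclideanSpace ℝ (Fin d)}
    (h : ‖u‖ = ‖v‖) (huv : inner ℝ u v = 0) :
    2 * ∫ x, ridgeForm ρ x u v ^ 2 ∂uniformSample d n =
      ∫ x, ridgeForm ρ x u u ^ 2 ∂uniformSample d n -
        ∫ x, ridgeForm ρ x u u * ridgeForm ρ x v v ∂uniformSample d n := by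
  have hs : (√2 / 2 : ℝ) ^ 2 = 1 / 2 := by rw [div_pow, Real.sq_sqrt] <;> norm_num
  set s : ℝ := √2 / 2
  have hvu : inner ℝ v u = 0 := by rw [real_inner_comm, huv]
  have n1 : ‖u‖ = ‖s • (u + v)‖ := by
    apply (sq_eq_sq₀ (norm_nonneg _) (norm_nonneg _)).mp
    rw [norm_smul, mul_pow, norm_add_sq_real, huv, Real.norm_eq_abs, sq_abs, hs, ← h]
    ring
  have n2 : ‖v‖ = ‖s • (u + (-1 : ℝ) • v)‖ := by
    apply (sq_eq_sq₀ (norm_nonneg _) (norm_nonneg _)).mp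
    rw [norm_smul, mul_pow, norm_add_sq_real, real_inner_smul_right, huv, Real.norm_eq_abs, sq_abs,
      hs, norm_smul, h]
    norm_num
    ring
  have n3 : inner ℝ (s • (u + v)) (s • (u + (-1 : ℝ) • v)) = 0 := by
    simp only [real_inner_smul_left, real_inner_smul_right, inner_add_left, inner_add_right, huv,
      hvu, real_inner_self_eq_norm_sq, h]
    ring
  rw [integral_ridgeForm_sq_congr hρ n1 n2 huv n3]
  have hq : ∀ x : Fin n → SqrtSphere d,
      ridgeForm ρ x (s • (u + v)) (s • (u + (-1 : ℝ) • v)) ^ 2 =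
        (1 / 4) * (ridgeForm ρ x u u ^ 2 + ridgeForm ρ x v v ^ 2) -
          (1 / 2) * (ridgeForm ρ x u u * ridgeForm ρ x v v) := fun x => by
    have e : ridgeForm ρ x (s • (u + v)) (s • (u + (-1 : ℝ) • v)) =
        s ^ 2 * (ridgeForm ρ x u u - ridgeForm ρ x v v) := by
      rw [ridgeForm_smul_right, ridgeForm_add_right, ridgeForm_smul_right,
        ridgeForm_comm ρ x _ u, ridgeForm_comm ρ x _ v, ridgeForm_smul_right,
        ridgeForm_smul_right, ridgeForm_add_right, ridgeForm_add_right, ridgeForm_comm ρ x v u]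
      ring
    rw [e, hs]
    ring
  have i1 (w : EuclideanSpace ℝ (Fin d)) :
      Integrable (fun x => ridgeForm ρ x w w ^ 2) (uniformSample d n) :=
    ((continuous_ridgeForm hρ w w).pow 2).integrable_of_compactSpace
  have i3 : Integrable (fun x => ridgeForm ρ x u u * ridgeForm ρ x v v) (uniformSample d n) :=
    ((continuous_ridgeForm hρ u u).mul (continuous_ridgeForm hρ v v)).integrable_of_compactSpace
  have i2 : Integrable (fun x => ridgeForm ρ x u u ^ 2 + ridgeForm ρ x v v ^ 2)
      (uniformSample d n) := (i1 u).add (i1 v)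
  simp_rw [hq]
  rw [integral_sub (i2.const_mul _) (i3.const_mul _), integral_const_mul,
    integral_const_mul, integral_add (i1 u) (i1 v), integral_ridgeForm_self_sq_congr hρ h]
  ring

lemma sum_sum_ite_eq_const {d : ℕ} (s t : ℝ) :
    ∑ a : Fin d, ∑ b : Fin d, (if a = b then s else t) = d * s + d * (d - 1) * t := by
  have : ∀ a b : Fin d, (if a = b then s else t) = t + if a = b then s - t else 0 := fun a b => by
    split_ifs <;> ring
  simp only [this, Finset.sum_add_distrib, Finset.sum_const, Finset.card_univ, Fintype.card_fin,
    nsmul_eq_mul, Finset.sum_ite_eq, Finset.mem_univ, if_true]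
  ring

/-- The off-diagonal second moment of `Xᵀ (K + ρ)⁻¹ X` in terms of the spectrum of `K`. -/
theorem integral_ridgeForm_sq_of_orthonormal (hρ : 0 < ρ) {u v : EuclideanSpace ℝ (Fin d)}
    (hu : ‖u‖ = 1) (hv : ‖v‖ = 1) (huv : inner ℝ u v = 0) :
    d * (d + 2) * (d - 1) * ∫ x, ridgeForm ρ x u v ^ 2 ∂uniformSample d n =
      d * ∫ x, spectralSumOne ρ x ∂uniformSample d n -
        ∫ x, spectralSumTwo ρ x ∂uniformSample d n := by
  let e := EuclideanSpace.basisFun (Fin d) ℝ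
  have hone : ∫ x, spectralSumOne ρ x ∂uniformSample d n = ∑ a : Fin d, ∑ b : Fin d,
      if a = b then ∫ x, ridgeForm ρ x u u ^ 2 ∂uniformSample d n
        else ∫ x, ridgeForm ρ x u v ^ 2 ∂uniformSample d n := by
    simp_rw [spectralSumOne_eq hρ]
    have hi : ∀ a b, Integrable (fun x => ridgeForm ρ x (e a) (e b) ^ 2) (uniformSample d n) :=
      fun a b => ((continuous_ridgeForm hρ _ _).pow 2).integrable_of_compactSpace
    rw [integral_finsetSum _ fun a _ => integrable_finsetSum _ fun b _ => hi a b]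
    refine Finset.sum_congr rfl fun a _ => ?_
    rw [integral_finsetSum _ fun b _ => hi a b]
    refine Finset.sum_congr rfl fun b _ => ?_
    split_ifs with hab
    · subst hab
      exact integral_ridgeForm_self_sq_congr hρ (by simp [hu])
    · exact integral_ridgeForm_sq_congr hρ (by simp [hu]) (by simp [hv])
        (e.orthonormal.2 hab) huv
  have htwo : ∫ x, spectralSumTwo ρ x ∂uniformSample d n = ∑ a : Fin d, ∑ b : Fin d,
      if a = b then ∫ x, ridgeForm ρ x u u ^ 2 ∂uniformSample d n
        else ∫ x, ridgeForm ρ x u u * ridgeForm ρ x v v ∂uniformSample d n := by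
    simp_rw [spectralSumTwo_eq hρ]
    have hi : ∀ a b, Integrable (fun x => ridgeForm ρ x (e a) (e a) * ridgeForm ρ x (e b) (e b))
        (uniformSample d n) := fun a b =>
      ((continuous_ridgeForm hρ _ _).mul (continuous_ridgeForm hρ _ _)).integrable_of_compactSpace
    rw [integral_finsetSum _ fun a _ => integrable_finsetSum _ fun b _ => hi a b]
    refine Finset.sum_congr rfl fun a _ => ?_
    rw [integral_finsetSum _ fun b _ => hi a b]
    refine Finset.sum_congr rfl fun b _ => ?_
    split_ifs with hab
    · subst hab
      simp_rw [← sq]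
      exact integral_ridgeForm_self_sq_congr hρ (by simp [hu])
    · exact integral_ridgeForm_mul_congr hρ (by simp [hu]) (by simp [hv])
        (e.orthonormal.2 hab) huv
  rw [hone, htwo, sum_sum_ite_eq_const, sum_sum_ite_eq_const]
  -- With `p, q, r` the three moments, the two sides differ by `d(d-1)(2q - p + r)`.
  linear_combination (d : ℝ) * (d - 1) * two_mul_integral_ridgeForm_sq hρ (hu.trans hv.symm) huv

theorem integral_ridgeForm_sq (hd : 1 < d) (hρ : 0 < ρ) {u θ : EuclideanSpace ℝ (Fin d)}
    (hu : ‖u‖ = 1) (huθ : inner ℝ u θ = 0) :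
    ∫ x, ridgeForm ρ x u θ ^ 2 ∂uniformSample d n =
      ‖θ‖ ^ 2 * (d * ∫ x, spectralSumOne ρ x ∂uniformSample d n -
        ∫ x, spectralSumTwo ρ x ∂uniformSample d n) / (d * (d + 2) * (d - 1)) := by
  have hd' : (1 : ℝ) < d := by exact_mod_cast hd
  rcases eq_or_ne θ 0 with rfl | hθ
  · simp [ridgeForm]
  have hθ' := norm_ne_zero_iff.mpr hθ
  have hv : ‖‖θ‖⁻¹ • θ‖ = 1 := by rw [norm_smul, norm_inv, norm_norm, inv_mul_cancel₀ hθ']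
  rw [← integral_ridgeForm_sq_of_orthonormal hρ hu hv (by rw [real_inner_smul_right, huθ, mul_zero])]
  simp_rw [ridgeForm_smul_right, mul_pow, integral_const_mul]
  have : (d : ℝ) - 1 ≠ 0 := by linarith
  have : (d : ℝ) + 2 ≠ 0 := by linarith
  have : (d : ℝ) ≠ 0 := by linarith
  field_simp

end Moments

/-! ## Orthogonal representations and the projection onto the fixed vectors -/

section Projection

variable {E : Type*} [NormedAddCommGroup E] [InnerProductSpace ℝ E] [FiniteDimensional ℝ E]

lemma norm_sq_starProjection_eq_sum (K : Submodule ℝ E) (v : E) :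
    ‖K.starProjection v‖ ^ 2 = ∑ k, inner ℝ (stdOrthonormalBasis ℝ K k : E) v ^ 2 := by
  have h := (stdOrthonormalBasis ℝ K).sum_sq_norm_inner_right (K.orthogonalProjectionOnto v)
  rw [Submodule.starProjection_apply, Submodule.norm_coe, ← h]
  refine Finset.sum_congr rfl fun k _ => ?_
  rw [Real.norm_eq_abs, sq_abs, Submodule.inner_orthogonalProjectionOnto_eq_of_mem_left]

/-- Swapping the sums, Parseval makes each basis vector of `K` contribute 1. -/
lemma sum_norm_sq_starProjection {ι : Type*} [Fintype ι] (K : Submodule ℝ E)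
    (b : OrthonormalBasis ι ℝ E) :
    ∑ i, ‖K.starProjection (b i)‖ ^ 2 = Module.finrank ℝ K := by
  simp_rw [norm_sq_starProjection_eq_sum]
  rw [Finset.sum_comm]
  have : ∀ k, ∑ i, inner ℝ (stdOrthonormalBasis ℝ K k : E) (b i) ^ 2 = 1 := fun k => by
    have h := b.sum_sq_norm_inner_left (stdOrthonormalBasis ℝ K k : E)
    simp only [Real.norm_eq_abs, sq_abs] at h
    rw [h, Submodule.norm_coe, (stdOrthonormalBasis ℝ K).norm_eq_one, one_pow]
  simp [this]

end Projection

section Representation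

variable {G : Type*} [Group G] {d : ℕ}

/-- The linear isometry of `ℝᵈ` given by `φ(g)`. -/
noncomputable def repIsometry (φ : G →* Matrix.orthogonalGroup (Fin d) ℝ) (g : G) :
    EuclideanSpace ℝ (Fin d) →ₗᵢ[ℝ] EuclideanSpace ℝ (Fin d) where
  toLinearMap := Matrix.toEuclideanLin (φ g : Matrix (Fin d) (Fin d) ℝ)
  norm_map' := norm_toLp_orthogonal_mulVec (φ g)

variable {φ : G →* Matrix.orthogonalGroup (Fin d) ℝ}

lemma coe_sphereAction (g : G) (x : SqrtSphere d) :
    (sphereAction φ g x : EuclideanSpace ℝ (Fin d)) = repIsometry φ g x := rfl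

lemma mem_symmetricSubspace_iff {w : EuclideanSpace ℝ (Fin d)} :
    w ∈ symmetricSubspace φ ↔ ∀ g, repIsometry φ g w = w := Iff.rfl

lemma repIsometry_mul (g h : G) (v : EuclideanSpace ℝ (Fin d)) :
    repIsometry φ (g * h) v = repIsometry φ g (repIsometry φ h v) := by
  change WithLp.toLp 2 (((φ (g * h) : Matrix.orthogonalGroup (Fin d) ℝ) :
    Matrix (Fin d) (Fin d) ℝ) *ᵥ v.ofLp) = WithLp.toLp 2 ((φ g : Matrix (Fin d) (Fin d) ℝ) *ᵥ
      ((φ h : Matrix (Fin d) (Fin d) ℝ) *ᵥ v.ofLp))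
  rw [map_mul, Submonoid.coe_mul, Matrix.mulVec_mulVec]

lemma repIsometry_basisFun (g : G) (i j : Fin d) :
    (φ g : Matrix (Fin d) (Fin d) ℝ) i j =
      inner ℝ (EuclideanSpace.basisFun (Fin d) ℝ i)
        (repIsometry φ g (EuclideanSpace.basisFun (Fin d) ℝ j)) := by
  change _ = inner ℝ _ (WithLp.toLp 2 ((φ g : Matrix (Fin d) (Fin d) ℝ) *ᵥ
    (EuclideanSpace.basisFun (Fin d) ℝ j).ofLp))
  simp [EuclideanSpace.inner_single_left]

/-- Serves to extend, by homogeneity, hypotheses about points of the sphere to all vectors. -/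
lemma exists_smul_sqrtSphere [NeZero d] (v : EuclideanSpace ℝ (Fin d)) :
    ∃ (c : ℝ) (x : SqrtSphere d), v = c • (x : EuclideanSpace ℝ (Fin d)) := by
  have hd : √(d : ℝ) ≠ 0 := (Real.sqrt_pos.mpr (by exact_mod_cast Nat.pos_of_neZero d)).ne'
  rcases eq_or_ne v 0 with rfl | hv
  · have : Nonempty (Fin d) := ⟨0⟩
    have : Nontrivial (EuclideanSpace ℝ (Fin d)) := inferInstance
    obtain ⟨x⟩ : Nonempty (SqrtSphere d) :=
      (NormedSpace.sphere_nonempty.mpr (Real.sqrt_nonneg _)).to_subtype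
    exact ⟨0, x, by simp⟩
  · have hv' := norm_ne_zero_iff.mpr hv
    refine ⟨‖v‖ / √(d : ℝ), ⟨(√(d : ℝ) / ‖v‖) • v, ?_⟩, ?_⟩
    · rw [mem_sphere_zero_iff_norm, norm_smul, Real.norm_of_nonneg (by positivity),
        div_mul_cancel₀ _ hv']
    · rw [smul_smul, div_mul_div_cancel₀ hd, div_self hv', one_smul]

/-- By homogeneity `⟨θ, φ(g)θ⟩ = ‖θ‖²`, while `φ(g)θ` has the norm of `θ`: the equality case of
Cauchy–Schwarz. -/
lemma mem_symmetricSubspace_of_linearTarget [NeZero d] {θ : EuclideanSpace ℝ (Fin d)}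
    (hθ : ∀ g x, linearTarget θ (sphereAction φ g x) = linearTarget θ x) :
    θ ∈ symmetricSubspace φ := by
  rw [mem_symmetricSubspace_iff]
  intro g
  have h1 : inner ℝ θ (repIsometry φ g θ) = inner ℝ θ θ := by
    obtain ⟨c, x, hx⟩ := exists_smul_sqrtSphere θ
    have := hθ g x
    simp only [linearTarget, coe_sphereAction] at this
    conv_lhs => rw [show repIsometry φ g θ = c • repIsometry φ g x by
      conv_lhs => rw [hx, map_smul]]
    conv_rhs => rw [show inner ℝ θ θ = inner ℝ θ (c • (x : EuclideanSpace ℝ (Fin d))) by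
      rw [← hx]]
    rw [real_inner_smul_right, real_inner_smul_right, this]
  have h2 : ‖repIsometry φ g θ - θ‖ ^ 2 = 0 := by
    rw [norm_sub_sq_real, real_inner_comm, h1, (repIsometry φ g).norm_map,
      real_inner_self_eq_norm_sq]
    ring
  exact sub_eq_zero.mp (norm_eq_zero.mp (pow_eq_zero_iff two_ne_zero |>.mp h2))

lemma starProjection_antisymmetricSubspace (v : EuclideanSpace ℝ (Fin d)) :
    (antisymmetricSubspace φ).starProjection v = v - (symmetricSubspace φ).starProjection v :=
  Submodule.starProjection_orthogonal_val v

variable [MeasurableSpace G]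

lemma measurable_repIsometry [NeZero d]
    (hφ : Measurable fun p : G × SqrtSphere d => sphereAction φ p.1 p.2)
    (v : EuclideanSpace ℝ (Fin d)) : Measurable fun g => repIsometry φ g v := by
  obtain ⟨c, x, rfl⟩ := exists_smul_sqrtSphere v
  simp_rw [map_smul]
  have h : Measurable fun g => (sphereAction φ g x : EuclideanSpace ℝ (Fin d)) :=
    measurable_subtype_coe.comp (hφ.comp (measurable_id.prodMk measurable_const))
  exact h.const_smul c

variable [NeZero d] (lam : Measure G) [IsProbabilityMeasure lam]

lemma integrable_repIsometry
    (hφ : Measurable fun p : G × SqrtSphere d => sphereAction φ p.1 p.2)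
    (v : EuclideanSpace ℝ (Fin d)) : Integrable (fun g => repIsometry φ g v) lam :=
  Integrable.of_bound (measurable_repIsometry hφ v).aestronglyMeasurable ‖v‖
    (.of_forall fun g => ((repIsometry φ g).norm_map v).le)

variable [MeasurableMul G] [lam.IsMulLeftInvariant]

/-- Averaging a representation over the group is the projection onto the fixed vectors. -/
theorem integral_repIsometry
    (hφ : Measurable fun p : G × SqrtSphere d => sphereAction φ p.1 p.2)
    (v : EuclideanSpace ℝ (Fin d)) :
    ∫ g, repIsometry φ g v ∂lam = (symmetricSubspace φ).starProjection v := by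
  have hint := integrable_repIsometry lam hφ v
  symm
  -- The average is fixed by left invariance of Haar measure. Its difference from `v` is orthogonal
  -- to each fixed `w`, since `⟨w, φ(g)v⟩ = ⟨φ(g)w, φ(g)v⟩ = ⟨w, v⟩`.
  apply Submodule.eq_starProjection_of_mem_of_inner_eq_zero
  · rw [mem_symmetricSubspace_iff]
    intro h
    have := (repIsometry φ h).toContinuousLinearMap.integral_comp_comm hint
    simp only [LinearIsometry.coe_toContinuousLinearMap, ← repIsometry_mul] at this
    rw [← this, integral_mul_left_eq_self (fun g => repIsometry φ g v) h]
  · intro w hw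
    rw [inner_sub_left, real_inner_comm, real_inner_comm w, ← integral_inner hint w]
    have : ∀ g, inner ℝ w (repIsometry φ g v) = inner ℝ w v := fun g => by
      conv_lhs => rw [← mem_symmetricSubspace_iff.mp hw g]
      exact (repIsometry φ g).inner_map_map w v
    simp [this]

lemma integral_inner_sphereAction
    (hφ : Measurable fun p : G × SqrtSphere d => sphereAction φ p.1 p.2)
    (w : EuclideanSpace ℝ (Fin d)) (x : SqrtSphere d) :
    ∫ g, inner ℝ w (sphereAction φ g x : EuclideanSpace ℝ (Fin d)) ∂lam =
      inner ℝ w ((symmetricSubspace φ).starProjection x) := by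
  simp_rw [coe_sphereAction]
  rw [integral_inner (integrable_repIsometry lam hφ _), integral_repIsometry lam hφ]

lemma orbitAverage_inner
    (hφ : Measurable fun p : G × SqrtSphere d => sphereAction φ p.1 p.2)
    (w : EuclideanSpace ℝ (Fin d)) (x : SqrtSphere d) :
    orbitAverage lam (sphereAction φ) (fun z => inner ℝ w (z : EuclideanSpace ℝ (Fin d))) x =
      inner ℝ ((symmetricSubspace φ).starProjection w) (x : EuclideanSpace ℝ (Fin d)) := by
  rw [orbitAverage, integral_inner_sphereAction lam hφ, Submodule.inner_starProjection_left_eq_right]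

/-- On linear functions `id - 𝒪` projects the coefficient vector onto `A`, and isotropy turns the
`L₂` norm into the Euclidean one. -/
lemma antisymNormSq_inner
    (hφ : Measurable fun p : G × SqrtSphere d => sphereAction φ p.1 p.2)
    (w : EuclideanSpace ℝ (Fin d)) :
    antisymNormSq (uniformSqrtSphere d) lam (sphereAction φ)
      (fun z => inner ℝ w (z : EuclideanSpace ℝ (Fin d))) =
        ‖(antisymmetricSubspace φ).starProjection w‖ ^ 2 := by
  rw [← integral_inner_sq_uniformSqrtSphere, antisymNormSq]
  simp_rw [orbitAverage_inner lam hφ, starProjection_antisymmetricSubspace, inner_sub_left]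

/-- `Φ` is the matrix of the orthogonal projection onto `S`, whose squared Frobenius norm is its
rank. -/
lemma frobeniusNormSq_averageMatrix
    (hφ : Measurable fun p : G × SqrtSphere d => sphereAction φ p.1 p.2) :
    frobeniusNormSq (averageMatrix lam φ) = Module.finrank ℝ (symmetricSubspace φ) := by
  let e := EuclideanSpace.basisFun (Fin d) ℝ
  have hent : ∀ i j, averageMatrix lam φ i j =
      inner ℝ (e i) ((symmetricSubspace φ).starProjection (e j)) := fun i j => by
    rw [← integral_repIsometry lam hφ, ← integral_inner (integrable_repIsometry lam hφ _)]
    simp only [averageMatrix, Matrix.of_apply, repIsometry_basisFun]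
    rfl
  rw [frobeniusNormSq, Finset.sum_comm, ← sum_norm_sq_starProjection _ e]
  refine Finset.sum_congr rfl fun j _ => ?_
  rw [← e.sum_sq_norm_inner_right]
  refine Finset.sum_congr rfl fun i _ => ?_
  rw [hent, Real.norm_eq_abs, sq_abs]

theorem sub_frobeniusNormSq_averageMatrix
    (hφ : Measurable fun p : G × SqrtSphere d => sphereAction φ p.1 p.2) :
    (d : ℝ) - frobeniusNormSq (averageMatrix lam φ) =
      Module.finrank ℝ (antisymmetricSubspace φ) := by
  have h := (symmetricSubspace φ).finrank_add_finrank_orthogonal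
  rw [finrank_euclideanSpace_fin] at h
  rw [frobeniusNormSq_averageMatrix lam hφ, antisymmetricSubspace]
  rw [sub_eq_iff_eq_add', ← Nat.cast_add, h]

/-- Here `k^⊥(x, y) = ⟨P_A y, x⟩`. Isotropy in `x` leaves `‖P_A y‖²`, and isotropy in `y` gives 1
for each basis vector of `A`. -/
theorem kernelL2NormSq_kernelPerp_linearKernel
    (hφ : Measurable fun p : G × SqrtSphere d => sphereAction φ p.1 p.2) :
    kernelL2NormSq (uniformSqrtSphere d) (kernelPerp lam (sphereAction φ) (linearKernel d)) =
      Module.finrank ℝ (antisymmetricSubspace φ) := by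
  set A := antisymmetricSubspace φ with hA
  have hperp : ∀ x y, kernelPerp lam (sphereAction φ) (linearKernel d) x y =
      inner ℝ (A.starProjection y) (x : EuclideanSpace ℝ (Fin d)) := fun x y => by
    rw [kernelPerp, kernelAverage, real_inner_comm, hA, starProjection_antisymmetricSubspace,
      inner_sub_right, ← integral_inner_sphereAction lam hφ]
    rfl
  have hcont : Continuous fun p : SqrtSphere d × SqrtSphere d =>
      inner ℝ (A.starProjection p.2) (p.1 : EuclideanSpace ℝ (Fin d)) ^ 2 := by
    fun_prop
  rw [kernelL2NormSq]
  simp_rw [hperp]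
  rw [integral_prod_symm _ hcont.integrable_of_compactSpace]
  simp_rw [integral_inner_sq_uniformSqrtSphere, norm_sq_starProjection_eq_sum]
  rw [integral_finsetSum _ fun k _ => integrable_inner_sq_sqrtSphere _]
  simp_rw [integral_inner_sq_uniformSqrtSphere, Submodule.norm_coe,
    (stdOrthonormalBasis ℝ A).norm_eq_one]
  simp

end Representation

lemma kernelSup_linearKernel (d : ℕ) [NeZero d] : kernelSup (linearKernel d) = d := by
  obtain ⟨-, x, -⟩ := exists_smul_sqrtSphere (0 : EuclideanSpace ℝ (Fin d))
  have : Nonempty (SqrtSphere d) := ⟨x⟩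
  have h : ∀ x, linearKernel d x x = d := fun x => by
    rw [linearKernel, real_inner_self_eq_norm_sq, norm_sq_coe_sqrtSphere]
  simp [kernelSup, h]

/-! ## Conditional moments of the noise -/

section CondExp

variable {Ω : Type*} {m m₀ : MeasurableSpace Ω} {P : Measure Ω}

/-- The bounded factor `c` is pulled out of the conditional expectation before integrating. -/
lemma integral_mul_of_condExp_ae_eq [IsFiniteMeasure P] (hm : m ≤ m₀) {c ζ g : Ω → ℝ} (hc : StronglyMeasurable[m] c)
    (hζ : Integrable ζ P) {C : ℝ} (hC : ∀ ω, |c ω| ≤ C) (hg : P[ζ | m] =ᵐ[P] g) :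
    ∫ ω, c ω * ζ ω ∂P = ∫ ω, c ω * g ω ∂P := by
  have h := condExp_stronglyMeasurable_mul_of_bound hm hc hζ C (.of_forall hC)
  rw [← integral_condExp hm]
  refine integral_congr_ae (h.trans ?_)
  filter_upwards [hg] with ω hω
  simp [hω]

lemma Continuous.exists_abs_le_of_compactSpace {α : Type*} [TopologicalSpace α] [CompactSpace α]
    {F : α → ℝ} (hF : Continuous F) :
    ∃ C, ∀ x, |F x| ≤ C := by
  obtain ⟨C, hC⟩ := isCompact_univ.exists_bound_of_continuousOn hF.continuousOn
  exact ⟨C, fun x => hC x (Set.mem_univ x)⟩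

variable {α : Type*} [TopologicalSpace α] [CompactSpace α] [MeasurableSpace α]
  [OpensMeasurableSpace α]

lemma Continuous.integrable_comp_of_compactSpace [IsFiniteMeasure P] {F : α → ℝ} (hF : Continuous F) {Z : Ω → α}
    (hZ : Measurable Z) : Integrable (fun ω => F (Z ω)) P := by
  obtain ⟨C, hC⟩ := hF.exists_abs_le_of_compactSpace
  exact Integrable.of_bound (hF.measurable.comp hZ).aestronglyMeasurable C (.of_forall fun ω => hC _)

lemma Continuous.integrable_comp_mul {F : α → ℝ} (hF : Continuous F) {Z : Ω → α}
    (hZ : Measurable Z) {ζ : Ω → ℝ} (hζ : Integrable ζ P) :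
    Integrable (fun ω => F (Z ω) * ζ ω) P := by
  obtain ⟨C, hC⟩ := hF.exists_abs_le_of_compactSpace
  exact hζ.bdd_mul (hF.measurable.comp hZ).aestronglyMeasurable (.of_forall fun ω => hC _)

lemma Continuous.memLp_comp_mul {F : α → ℝ} (hF : Continuous F) {Z : Ω → α}
    (hZ : Measurable Z) {ζ : Ω → ℝ} (hζ : MemLp ζ 2 P) :
    MemLp (fun ω => F (Z ω) * ζ ω) 2 P := by
  obtain ⟨C, hC⟩ := hF.exists_abs_le_of_compactSpace
  have h : MemLp (fun ω => F (Z ω)) ⊤ P :=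
    memLp_top_of_bound (hF.measurable.comp hZ).aestronglyMeasurable C (.of_forall fun ω => hC _)
  exact hζ.mul h

lemma integral_comp_mul_of_condExp_comap [IsFiniteMeasure P] {F : α → ℝ} (hF : Continuous F) {Z : Ω → α}
    (hZ : Measurable Z) {ζ g : Ω → ℝ} (hζ : Integrable ζ P)
    (hg : P[ζ | MeasurableSpace.comap Z inferInstance] =ᵐ[P] g) :
    ∫ ω, F (Z ω) * ζ ω ∂P = ∫ ω, F (Z ω) * g ω ∂P := by
  obtain ⟨C, hC⟩ := hF.exists_abs_le_of_compactSpace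
  exact integral_mul_of_condExp_ae_eq hZ.comap_le
    (hF.measurable.comp (comap_measurable Z)).stronglyMeasurable hζ (fun ω => hC _) hg

end CondExp

/-! ## Risk of linear predictors and second moments of the ridge estimator -/

lemma risk_nonneg {Ω 𝒳 : Type*} [MeasurableSpace Ω] (P : Measure Ω) (X : Ω → 𝒳) (Y : Ω → ℝ)
    (h : 𝒳 → ℝ) : 0 ≤ risk P X Y h :=
  integral_nonneg fun _ => sq_nonneg _

section Regression

variable {d : ℕ}

/-- The cross term with the noise vanishes by the conditional mean; isotropy evaluates the remaining
quadratic term. -/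
lemma risk_inner_eq [NeZero d] {Ω : Type*} [MeasurableSpace Ω] {P : Measure Ω} [IsProbabilityMeasure P]
    {X : Ω → SqrtSphere d} {Y ξ : Ω → ℝ} {θ : EuclideanSpace ℝ (Fin d)} (hX : Measurable X)
    (hξ : MemLp ξ 2 P) (hY : ∀ ω, Y ω = linearTarget θ (X ω) + ξ ω)
    (hlaw : P.map X = uniformSqrtSphere d)
    (hmean : P[ξ | MeasurableSpace.comap X inferInstance] =ᵐ[P] 0)
    (hvar : ∫ ω, ξ ω ^ 2 ∂P = 1) (w : EuclideanSpace ℝ (Fin d)) :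
    risk P X Y (fun z => inner ℝ w (z : EuclideanSpace ℝ (Fin d))) = ‖w - θ‖ ^ 2 + 1 := by
  let F : SqrtSphere d → ℝ := fun z => inner ℝ (w - θ) (z : EuclideanSpace ℝ (Fin d))
  have hF : Continuous F := continuous_const.inner continuous_subtype_val
  have hexp : ∀ ω, (inner ℝ w (X ω : EuclideanSpace ℝ (Fin d)) - Y ω) ^ 2 =
      F (X ω) ^ 2 - 2 * (F (X ω) * ξ ω) + ξ ω ^ 2 := fun ω => by
    simp only [F, inner_sub_left, hY, linearTarget]
    ring
  have hξ1 : Integrable ξ P := hξ.integrable (by norm_num)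
  have i1 : Integrable (fun ω => F (X ω) ^ 2) P :=
    Continuous.integrable_comp_of_compactSpace (F := fun z => F z ^ 2) (hF.pow 2) hX
  have i2 : Integrable (fun ω => 2 * (F (X ω) * ξ ω)) P := (hF.integrable_comp_mul hX hξ1).const_mul 2
  have i12 : Integrable (fun ω => F (X ω) ^ 2 - 2 * (F (X ω) * ξ ω)) P := i1.sub i2
  have e1 : ∫ ω, F (X ω) ^ 2 ∂P = ‖w - θ‖ ^ 2 := by
    have hF2 : Continuous fun z => F z ^ 2 := hF.pow 2
    rw [← integral_inner_sq_uniformSqrtSphere, ← hlaw,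
      integral_map hX.aemeasurable hF2.aestronglyMeasurable]
  have e2 : ∫ ω, F (X ω) * ξ ω ∂P = 0 := by
    rw [integral_comp_mul_of_condExp_comap hF hX hξ1 hmean]
    simp
  rw [risk]
  simp_rw [hexp]
  rw [integral_add i12 hξ.integrable_sq, integral_sub i1 i2, integral_const_mul, e1, e2, hvar]
  ring

variable {n : ℕ} {ρ : ℝ} {θ : EuclideanSpace ℝ (Fin d)} {Ω : Type*}
  {X : Fin n → Ω → SqrtSphere d} {Y ξ : Fin n → Ω → ℝ}

lemma inner_ridgeVector_eq (hY : ∀ i ω, Y i ω = linearTarget θ (X i ω) + ξ i ω)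
    (u : EuclideanSpace ℝ (Fin d)) (ω : Ω) :
    inner ℝ u (ridgeVector ρ (fun i => X i ω) fun i => Y i ω) =
      ridgeForm ρ (fun i => X i ω) u θ + ∑ i, ridgeCoeff ρ (fun i => X i ω) u i * ξ i ω := by
  rw [inner_ridgeVector, ridgeForm, ← Finset.sum_add_distrib]
  exact Finset.sum_congr rfl fun i _ => by rw [hY, linearTarget]; ring

variable [MeasurableSpace Ω] {P : Measure Ω}

lemma integral_comp_sample (hX : ∀ i, Measurable (X i))
    (hlaw : P.map (fun ω i => X i ω) = uniformSample d n) {F : (Fin n → SqrtSphere d) → ℝ}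
    (hF : Continuous F) : ∫ ω, F (fun i => X i ω) ∂P = ∫ x, F x ∂uniformSample d n := by
  rw [← hlaw, integral_map (measurable_pi_lambda _ hX).aemeasurable hF.aestronglyMeasurable]

variable [IsProbabilityMeasure P]

lemma memLp_inner_ridgeVector (hρ : 0 < ρ) (hX : ∀ i, Measurable (X i))
    (hξ : ∀ i, MemLp (ξ i) 2 P) (hY : ∀ i ω, Y i ω = linearTarget θ (X i ω) + ξ i ω)
    (u : EuclideanSpace ℝ (Fin d)) :
    MemLp (fun ω => inner ℝ u (ridgeVector ρ (fun i => X i ω) fun i => Y i ω)) 2 P := by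
  have hXs : Measurable fun ω i => X i ω := measurable_pi_lambda _ hX
  simp_rw [inner_ridgeVector_eq hY]
  refine MemLp.add ?_ (memLp_finsetSum _ fun i _ =>
    (continuous_ridgeCoeff hρ u i).memLp_comp_mul hXs (hξ i))
  obtain ⟨C, hC⟩ := (continuous_ridgeForm (n := n) hρ u θ).exists_abs_le_of_compactSpace
  exact MemLp.of_bound ((continuous_ridgeForm hρ u θ).measurable.comp hXs).aestronglyMeasurable C
    (.of_forall fun ω => hC _)

/-- The second moment of the ridge estimator in a direction is bias plus variance. -/
theorem integral_inner_ridgeVector_sq (hρ : 0 < ρ) (hX : ∀ i, Measurable (X i))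
    (hξ : ∀ i, MemLp (ξ i) 2 P) (hY : ∀ i ω, Y i ω = linearTarget θ (X i ω) + ξ i ω)
    (hmean : ∀ i, P[ξ i | MeasurableSpace.comap (fun ω l => X l ω) inferInstance] =ᵐ[P] 0)
    (hcov : ∀ i j,
      P[fun ω => ξ i ω * ξ j ω | MeasurableSpace.comap (fun ω l => X l ω) inferInstance]
        =ᵐ[P] fun _ => if i = j then 1 else 0)
    (u : EuclideanSpace ℝ (Fin d)) :
    ∫ ω, inner ℝ u (ridgeVector ρ (fun i => X i ω) fun i => Y i ω) ^ 2 ∂P =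
      ∫ ω, ridgeForm ρ (fun i => X i ω) u θ ^ 2 ∂P +
        ∫ ω, ∑ i, ridgeCoeff ρ (fun i => X i ω) u i ^ 2 ∂P := by
  have hXs : Measurable fun ω i => X i ω := measurable_pi_lambda _ hX
  let q : (Fin n → SqrtSphere d) → ℝ := fun x => ridgeForm ρ x u θ
  let c : Fin n → (Fin n → SqrtSphere d) → ℝ := fun i x => ridgeCoeff ρ x u i
  have hq : Continuous q := continuous_ridgeForm hρ u θ
  have hc : ∀ i, Continuous (c i) := continuous_ridgeCoeff hρ u
  have hexp : ∀ ω, inner ℝ u (ridgeVector ρ (fun i => X i ω) fun i => Y i ω) ^ 2 =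
      q (fun i => X i ω) ^ 2 +
        (∑ i, (2 * q (fun i => X i ω) * c i (fun i => X i ω)) * ξ i ω +
        ∑ i, ∑ j, (c i (fun i => X i ω) * c j (fun i => X i ω)) * (ξ i ω * ξ j ω)) := fun ω => by
    rw [inner_ridgeVector_eq hY, add_sq, sq (∑ i, _), Finset.sum_mul_sum, Finset.mul_sum, add_assoc]
    congr 2
    · exact Finset.sum_congr rfl fun i _ => by ring
    · exact Finset.sum_congr rfl fun i _ => Finset.sum_congr rfl fun j _ => by ring
  have hξ1 : ∀ i, Integrable (ξ i) P := fun i => (hξ i).integrable (by norm_num)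
  have hξ2 : ∀ i j, Integrable (fun ω => ξ i ω * ξ j ω) P := fun i j => (hξ i).integrable_mul (hξ j)
  have hqc : ∀ i, Continuous fun x => 2 * q x * c i x := fun i => (hq.const_mul 2).mul (hc i)
  have hcc : ∀ i j, Continuous fun x => c i x * c j x := fun i j => (hc i).mul (hc j)
  have i1 : Integrable (fun ω => q (fun i => X i ω) ^ 2) P :=
    Continuous.integrable_comp_of_compactSpace (F := fun x => q x ^ 2) (hq.pow 2) hXs
  have i2 := fun i => (hqc i).integrable_comp_mul hXs (hξ1 i)
  have i3 := fun i j => (hcc i j).integrable_comp_mul hXs (hξ2 i j)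
  have i2s := integrable_finsetSum Finset.univ fun i _ => i2 i
  have i3s := integrable_finsetSum Finset.univ fun i _ =>
    integrable_finsetSum Finset.univ fun j _ => i3 i j
  have e2 : ∀ i, ∫ ω, 2 * q (fun i => X i ω) * c i (fun i => X i ω) * ξ i ω ∂P = 0 := fun i => by
    rw [integral_comp_mul_of_condExp_comap (hqc i) hXs (hξ1 i) (hmean i)]
    simp
  -- Conditionally on the inputs the noise is uncorrelated with unit variance, so only the diagonal
  -- terms survive.
  have e3 : ∀ i j, ∫ ω, c i (fun i => X i ω) * c j (fun i => X i ω) * (ξ i ω * ξ j ω) ∂P =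
      if i = j then ∫ ω, c i (fun i => X i ω) ^ 2 ∂P else 0 := fun i j => by
    rw [integral_comp_mul_of_condExp_comap (hcc i j) hXs (hξ2 i j) (hcov i j)]
    split_ifs with hij
    · subst hij
      simp [sq]
    · simp
  simp_rw [hexp]
  have i23 : Integrable (fun ω => ∑ i, (2 * q (fun i => X i ω) * c i (fun i => X i ω)) * ξ i ω +
      ∑ i, ∑ j, (c i (fun i => X i ω) * c j (fun i => X i ω)) * (ξ i ω * ξ j ω)) P := i2s.add i3s
  rw [integral_add i1 i23, integral_add i2s i3s,
    integral_finsetSum _ fun i _ => i2 i,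
    integral_finsetSum _ fun i _ => integrable_finsetSum Finset.univ fun j _ => i3 i j,
    integral_finsetSum _ fun i _ => Continuous.integrable_comp_of_compactSpace
      (F := fun x => c i x ^ 2) ((hc i).pow 2) hXs]
  congr 1
  simp_rw [e2, Finset.sum_const_zero, zero_add]
  refine Finset.sum_congr rfl fun i _ => ?_
  rw [integral_finsetSum _ fun j _ => i3 i j]
  simp [e3]

/-- Integrates `sum_inner_sq_le_ridgeCoeff`, whose left side has mean `n` by isotropy. -/
theorem le_integral_sum_ridgeCoeff_sq [NeZero d] (hρ : 0 < ρ) (hX : ∀ i, Measurable (X i))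
    (hlaw : ∀ i, P.map (X i) = uniformSqrtSphere d) {u : EuclideanSpace ℝ (Fin d)}
    (hu : ‖u‖ = 1) :
    n / (n * d + ρ) ^ 2 ≤ ∫ ω, ∑ i, ridgeCoeff ρ (fun i => X i ω) u i ^ 2 ∂P := by
  have hXs : Measurable fun ω i => X i ω := measurable_pi_lambda _ hX
  have hinner : ∀ i, ∫ ω, inner ℝ u (X i ω : EuclideanSpace ℝ (Fin d)) ^ 2 ∂P = 1 := fun i => by
    have h := integral_inner_sq_uniformSqrtSphere u
    rw [← hlaw i, integral_map (hX i).aemeasurable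
      ((measurable_inner_sqrtSphere u).pow_const 2).aestronglyMeasurable, hu, one_pow] at h
    exact h
  have hint : ∀ i, Integrable (fun ω => inner ℝ u (X i ω : EuclideanSpace ℝ (Fin d)) ^ 2) P :=
    fun i => Continuous.integrable_comp_of_compactSpace
      (F := fun z : SqrtSphere d => inner ℝ u (z : EuclideanSpace ℝ (Fin d)) ^ 2)
      (by fun_prop) (hX i)
  have hsum : ∫ ω, ∑ i, inner ℝ u (X i ω : EuclideanSpace ℝ (Fin d)) ^ 2 ∂P = n := by
    rw [integral_finsetSum _ fun i _ => hint i]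
    simp [hinner]
  rw [div_le_iff₀' (by positivity), ← integral_const_mul]
  refine hsum.symm.le.trans ?_
  refine integral_mono (integrable_finsetSum _ fun i _ => hint i) (Integrable.const_mul ?_ _)
    fun ω => sum_inner_sq_le_ridgeCoeff hρ _ u
  exact Continuous.integrable_comp_of_compactSpace
    (F := fun x : Fin n → SqrtSphere d => ∑ i, ridgeCoeff ρ x u i ^ 2)
    (continuous_finsetSum _ fun i _ => (continuous_ridgeCoeff hρ u i).pow 2) hXs

lemma map_sample_eq (hX : ∀ i, Measurable (X i)) (hlaw : ∀ i, P.map (X i) = uniformSqrtSphere d)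
    (hindep : iIndepFun (fun i ω => (X i ω, Y i ω)) P) :
    P.map (fun ω i => X i ω) = uniformSample d n := by
  have h : iIndepFun X P := hindep.comp (fun _ => Prod.fst) fun _ => measurable_fst
  rw [(iIndepFun_iff_map_fun_eq_pi_map fun i => (hX i).aemeasurable).mp h, uniformSample]
  simp_rw [hlaw]

end Regression

/-! ### Assembly of the bias and variance bounds over an orthonormal basis of `A`. -/

theorem mainTheorem8
    -- the input dimension, the sample size, the regularisation and the target
    (d n : ℕ) (hd : 1 < d) (hn : 0 < n) (ρ : ℝ) (hρ : 0 < ρ)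
    (θ : EuclideanSpace ℝ (Fin d))
    -- the group, its normalised Haar measure and the orthogonal representation
    {G : Type*} [Group G] [TopologicalSpace G] [IsTopologicalGroup G] [CompactSpace G]
    [T2Space G] [SecondCountableTopology G] [MeasurableSpace G] [BorelSpace G]
    (lam : Measure G) [lam.IsHaarMeasure] [IsProbabilityMeasure lam]
    (φ : G →* Matrix.orthogonalGroup (Fin d) ℝ)
    (hφ : Measurable fun p : G × SqrtSphere d => sphereAction φ p.1 p.2)
    (hθ : ∀ g x, linearTarget θ (sphereAction φ g x) = linearTarget θ x)
    -- the reproducing kernel Hilbert space of the linear kernel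
    {H : Type*} [NormedAddCommGroup H] [InnerProductSpace ℝ H] [CompleteSpace H]
    [RKHS ℝ H (SqrtSphere d) ℝ] (hH : HasReproducingKernel H (linearKernel d))
    -- the training sample
    {Ω : Type*} [MeasurableSpace Ω] (P : Measure Ω) [IsProbabilityMeasure P]
    (X : Fin n → Ω → SqrtSphere d) (Y ξ : Fin n → Ω → ℝ)
    (hXmeas : ∀ i, Measurable (X i)) (hξL2 : ∀ i, MemLp (ξ i) 2 P)
    (hY : ∀ i ω, Y i ω = linearTarget θ (X i ω) + ξ i ω)
    (hXlaw : ∀ i, P.map (X i) = uniformSqrtSphere d)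
    (hindep : iIndepFun (fun i ω => (X i ω, Y i ω)) P)
    (hident : ∀ i j, IdentDistrib (fun ω => (X i ω, Y i ω)) (fun ω => (X j ω, Y j ω)) P P)
    (hξmean : ∀ i, P[ξ i | MeasurableSpace.comap (fun ω l => X l ω) inferInstance] =ᵐ[P] 0)
    (hξcov : ∀ i j,
      P[fun ω => ξ i ω * ξ j ω | MeasurableSpace.comap (fun ω l => X l ω) inferInstance]
        =ᵐ[P] fun _ => if i = j then 1 else 0)
    -- the test pair
    {Ω' : Type*} [MeasurableSpace Ω'] (P' : Measure Ω') [IsProbabilityMeasure P']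
    (X' : Ω' → SqrtSphere d) (Y' ξ' : Ω' → ℝ)
    (hX'meas : Measurable X') (hξ'L2 : MemLp ξ' 2 P')
    (hY' : ∀ ω, Y' ω = linearTarget θ (X' ω) + ξ' ω)
    (hX'law : P'.map X' = uniformSqrtSphere d)
    (hξ'mean : P'[ξ' | MeasurableSpace.comap X' inferInstance] =ᵐ[P'] 0)
    (hξ'var : ∫ ω, ξ' ω ^ 2 ∂P' = 1)
    -- the KRR solution, the solution of the noiseless problem, and the competitor
    (f Λf : Ω → H)
    (hf : ∀ ω, IsKRRSolution ρ (fun i => X i ω) (fun i => Y i ω) (f ω))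
    (hΛf : ∀ ω, IsKRRSolution ρ (fun i => X i ω) (fun i => linearTarget θ (X i ω)) (Λf ω))
    (f' : Ω → SqrtSphere d → ℝ)
    (hf'L2 : ∀ ω, MemLp (f' ω) 2 (uniformSqrtSphere d))
    (hf'meas : AEMeasurable (fun ω => risk P' X' Y' (f' ω)) P)
    (hf'risk : ∀ᵐ ω ∂P, risk P' X' Y' (f' ω) ≤
      risk P' X' Y' (orbitAverage lam (sphereAction φ) (f ω))) :
    -- all expectations below are of integrable random variables
    Integrable (fun ω => risk P' X' Y' (f ω) - risk P' X' Y' (f' ω)) P ∧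
    Integrable (fun ω => antisymNormSq (uniformSqrtSphere d) lam (sphereAction φ) (Λf ω)) P ∧
    Integrable (fun ω => spectralSumOne ρ (fun i => X i ω)) P ∧
    Integrable (fun ω => spectralSumTwo ρ (fun i => X i ω)) P ∧
    -- the bound
    ‖θ‖ ^ 2 * (d * zetaOne P X ρ - zetaTwo P X ρ) * (d - frobeniusNormSq (averageMatrix lam φ)) /
          (d * (d + 2) * (d - 1)) +
        (d - frobeniusNormSq (averageMatrix lam φ)) / (d * √(n : ℝ) + ρ / √(n : ℝ)) ^ 2
      ≤ ∫ ω, (risk P' X' Y' (f ω) - risk P' X' Y' (f' ω)) ∂P ∧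
    -- the first term is exactly the bias term
    ∫ ω, antisymNormSq (uniformSqrtSphere d) lam (sphereAction φ) (Λf ω) ∂P =
      ‖θ‖ ^ 2 * (d * zetaOne P X ρ - zetaTwo P X ρ) *
          (d - frobeniusNormSq (averageMatrix lam φ)) / (d * (d + 2) * (d - 1)) ∧
    -- the second term is exactly the variance term
    kernelL2NormSq (uniformSqrtSphere d) (kernelPerp lam (sphereAction φ) (linearKernel d)) /
        (√(n : ℝ) * kernelSup (linearKernel d) + ρ / √(n : ℝ)) ^ 2 =
      (d - frobeniusNormSq (averageMatrix lam φ)) / (d * √(n : ℝ) + ρ / √(n : ℝ)) ^ 2 ∧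
    -- both terms are non-negative
    0 ≤ ‖θ‖ ^ 2 * (d * zetaOne P X ρ - zetaTwo P X ρ) *
          (d - frobeniusNormSq (averageMatrix lam φ)) / (d * (d + 2) * (d - 1)) ∧
    0 ≤ (d - frobeniusNormSq (averageMatrix lam φ)) / (d * √(n : ℝ) + ρ / √(n : ℝ)) ^ 2 ∧
    -- the dimension of the anti-symmetric subspace
    (d : ℝ) - frobeniusNormSq (averageMatrix lam φ) =
      Module.finrank ℝ (antisymmetricSubspace φ) := by
  have : NeZero d := ⟨by omega⟩
  have hn' : (0 : ℝ) < n := by exact_mod_cast hn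
  have hXs : Measurable fun ω i => X i ω := measurable_pi_lambda _ hXmeas
  have hlaw := map_sample_eq hXmeas hXlaw hindep
  have hθS := mem_symmetricSubspace_of_linearTarget hθ
  set S := symmetricSubspace φ
  set A := antisymmetricSubspace φ with hA
  have hdim := sub_frobeniusNormSq_averageMatrix lam hφ
  rw [← hA] at hdim
  have hone : Integrable (fun ω => spectralSumOne ρ (fun i => X i ω)) P :=
    (continuous_spectralSumOne hρ).integrable_comp_of_compactSpace hXs
  have htwo : Integrable (fun ω => spectralSumTwo ρ (fun i => X i ω)) P :=
    (continuous_spectralSumTwo hρ).integrable_comp_of_compactSpace hXs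
  let a := stdOrthonormalBasis ℝ A
  have ha : ∀ k, ‖(a k : EuclideanSpace ℝ (Fin d))‖ = 1 := fun k => by
    rw [Submodule.norm_coe, a.norm_eq_one]
  have haθ : ∀ k, inner ℝ (a k : EuclideanSpace ℝ (Fin d)) θ = 0 := fun k =>
    Submodule.inner_left_of_mem_orthogonal hθS (a k).2
  -- the bias term
  have hbias : ∀ k, ∫ ω, ridgeForm ρ (fun i => X i ω) (a k : EuclideanSpace ℝ (Fin d)) θ ^ 2 ∂P =
      ‖θ‖ ^ 2 * (d * zetaOne P X ρ - zetaTwo P X ρ) / (d * (d + 2) * (d - 1)) := fun k => by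
    rw [zetaOne, zetaTwo, integral_comp_sample hXmeas hlaw (continuous_spectralSumOne hρ),
      integral_comp_sample hXmeas hlaw (continuous_spectralSumTwo hρ),
      ← integral_ridgeForm_sq hd hρ (ha k) (haθ k)]
    exact integral_comp_sample hXmeas hlaw
      (F := fun x => ridgeForm ρ x (a k : EuclideanSpace ℝ (Fin d)) θ ^ 2)
      ((continuous_ridgeForm hρ _ _).pow 2)
  have hanti : ∀ ω, antisymNormSq (uniformSqrtSphere d) lam (sphereAction φ) (Λf ω) =
      ∑ k, ridgeForm ρ (fun i => X i ω) (a k : EuclideanSpace ℝ (Fin d)) θ ^ 2 := fun ω => by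
    have h : ⇑(Λf ω) = fun z : SqrtSphere d => inner ℝ
        (ridgeVector ρ (fun i => X i ω) fun i => linearTarget θ (X i ω))
          (z : EuclideanSpace ℝ (Fin d)) :=
      funext fun z => (hΛf ω).apply_eq hH hρ z
    rw [h, antisymNormSq_inner lam hφ, norm_sq_starProjection_eq_sum]
    refine Finset.sum_congr rfl fun k _ => ?_
    rw [inner_ridgeVector]
    rfl
  have hformint : ∀ k, Integrable
      (fun ω => ridgeForm ρ (fun i => X i ω) (a k : EuclideanSpace ℝ (Fin d)) θ ^ 2) P := fun k =>
    Continuous.integrable_comp_of_compactSpace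
      (F := fun x : Fin n → SqrtSphere d => ridgeForm ρ x (a k : EuclideanSpace ℝ (Fin d)) θ ^ 2)
      ((continuous_ridgeForm hρ _ _).pow 2) hXs
  have hbiasEq : ∫ ω, antisymNormSq (uniformSqrtSphere d) lam (sphereAction φ) (Λf ω) ∂P =
      ‖θ‖ ^ 2 * (d * zetaOne P X ρ - zetaTwo P X ρ) *
        (d - frobeniusNormSq (averageMatrix lam φ)) / (d * (d + 2) * (d - 1)) := by
    simp_rw [hanti]
    rw [integral_finsetSum _ fun k _ => hformint k]
    simp_rw [hbias]
    rw [hdim, Finset.sum_const, Finset.card_univ, Fintype.card_fin, nsmul_eq_mul]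
    ring
  -- the risk gap
  let w : Ω → EuclideanSpace ℝ (Fin d) := fun ω =>
    ridgeVector ρ (fun i => X i ω) fun i => Y i ω
  have hfw : ∀ ω, ⇑(f ω) = fun z : SqrtSphere d => inner ℝ (w ω) (z : EuclideanSpace ℝ (Fin d)) :=
    fun ω => funext fun z => (hf ω).apply_eq hH hρ z
  have hRf : ∀ ω, risk P' X' Y' (f ω) = ‖w ω - θ‖ ^ 2 + 1 := fun ω => by
    rw [hfw, risk_inner_eq hX'meas hξ'L2 hY' hX'law hξ'mean hξ'var]
  have hgap : ∀ ω, risk P' X' Y' (f ω) -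
      risk P' X' Y' (orbitAverage lam (sphereAction φ) (f ω)) =
        ∑ k, inner ℝ (a k : EuclideanSpace ℝ (Fin d)) (w ω) ^ 2 := fun ω => by
    have hRbar : risk P' X' Y' (orbitAverage lam (sphereAction φ) (f ω)) =
        ‖S.starProjection (w ω) - θ‖ ^ 2 + 1 := by
      rw [hfw, funext (orbitAverage_inner lam hφ (w ω)),
        risk_inner_eq hX'meas hξ'L2 hY' hX'law hξ'mean hξ'var]
    -- As `θ ∈ S`, the two summands lie in `S` and `A`, so Pythagoras isolates the `A` part.
    have hdecomp : w ω - θ = (S.starProjection (w ω) - θ) + A.starProjection (w ω) := by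
      rw [hA, starProjection_antisymmetricSubspace]
      abel
    have horth : inner ℝ (S.starProjection (w ω) - θ) (A.starProjection (w ω)) = 0 :=
      Submodule.inner_right_of_mem_orthogonal
        (S.sub_mem (Submodule.starProjection_apply_mem _ _) hθS)
        (Submodule.starProjection_apply_mem A _)
    rw [hRf, hRbar, hdecomp, norm_add_sq_real, horth, ← norm_sq_starProjection_eq_sum]
    ring
  have hwint : ∀ u : EuclideanSpace ℝ (Fin d), Integrable (fun ω => inner ℝ u (w ω) ^ 2) P :=
    fun u => (memLp_inner_ridgeVector hρ hXmeas hξL2 hY u).integrable_sq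
  have hRfint : Integrable (fun ω => risk P' X' Y' (f ω)) P := by
    simp_rw [hRf, ← (EuclideanSpace.basisFun (Fin d) ℝ).sum_sq_norm_inner_right, inner_sub_right,
      Real.norm_eq_abs, sq_abs]
    exact (integrable_finsetSum _ fun i _ => ((memLp_inner_ridgeVector hρ hXmeas hξL2 hY _).sub
      (memLp_const _)).integrable_sq).add (integrable_const 1)
  have hgapint : Integrable (fun ω => risk P' X' Y' (f ω) -
      risk P' X' Y' (orbitAverage lam (sphereAction φ) (f ω))) P := by
    simp_rw [hgap]
    exact integrable_finsetSum _ fun k _ => hwint _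
  -- Domination: `0 ≤ R[f'] ≤ R[𝒪 f] ≤ R[f]`, the last because the gap is a sum of squares.
  have hf'int : Integrable (fun ω => risk P' X' Y' (f' ω)) P := by
    refine hRfint.mono' hf'meas.aestronglyMeasurable ?_
    filter_upwards [hf'risk] with ω hω
    rw [Real.norm_of_nonneg (risk_nonneg _ _ _ _)]
    refine hω.trans (sub_nonneg.mp ?_)
    rw [hgap]
    exact Finset.sum_nonneg fun _ _ => sq_nonneg _
  -- Matches the stated denominator with the form `n / (nd + ρ)²` of the variance bound.
  have hscale : (d * √(n : ℝ) + ρ / √(n : ℝ)) ^ 2 = (n * d + ρ) ^ 2 / n := by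
    have hsn : √(n : ℝ) ≠ 0 := (Real.sqrt_pos.mpr hn').ne'
    have hsq : √(n : ℝ) ^ 2 = n := Real.sq_sqrt hn'.le
    field_simp
    simp only [hsq]
    ring
  have hterm : ∀ k, ‖θ‖ ^ 2 * (d * zetaOne P X ρ - zetaTwo P X ρ) / (d * (d + 2) * (d - 1)) +
      n / (n * d + ρ) ^ 2 ≤ ∫ ω, inner ℝ (a k : EuclideanSpace ℝ (Fin d)) (w ω) ^ 2 ∂P :=
    fun k => by
      rw [integral_inner_ridgeVector_sq hρ hXmeas hξL2 hY hξmean hξcov, hbias]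
      gcongr
      exact le_integral_sum_ridgeCoeff_sq hρ hXmeas hXlaw (ha k)
  refine ⟨hRfint.sub hf'int, ?_, hone, htwo, ?_, hbiasEq, ?_, ?_, ?_, hdim⟩
  · simp_rw [hanti]
    exact integrable_finsetSum _ fun k _ => hformint k
  · calc _ = ∑ k : Fin (Module.finrank ℝ A),
          (‖θ‖ ^ 2 * (d * zetaOne P X ρ - zetaTwo P X ρ) / (d * (d + 2) * (d - 1)) +
            n / (n * d + ρ) ^ 2) := by
          rw [hdim, hscale, Finset.sum_const, Finset.card_univ, Fintype.card_fin, nsmul_eq_mul,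
            div_div_eq_mul_div]
          ring
      _ ≤ ∑ k, ∫ ω, inner ℝ (a k : EuclideanSpace ℝ (Fin d)) (w ω) ^ 2 ∂P :=
          Finset.sum_le_sum fun k _ => hterm k
      _ = ∫ ω, (risk P' X' Y' (f ω) -
            risk P' X' Y' (orbitAverage lam (sphereAction φ) (f ω))) ∂P := by
          simp_rw [hgap]
          rw [integral_finsetSum _ fun k _ => hwint _]
      _ ≤ _ := by
          refine integral_mono_ae hgapint (hRfint.sub hf'int) ?_
          filter_upwards [hf'risk] with ω hω
          exact sub_le_sub_left hω _
  · rw [kernelL2NormSq_kernelPerp_linearKernel lam hφ, kernelSup_linearKernel, hdim,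
      mul_comm (√(n : ℝ))]
  · rw [← hbiasEq]
    exact integral_nonneg fun ω => integral_nonneg fun _ => sq_nonneg _
  · rw [hdim]
    positivity
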